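/- Let $V\in C^\infty(\mathbb R)$ be real-valued and even, $V(-x)=V(x)$, and suppose $V=V_{\rm per}+V_{\rm def}$, where $V_{\rm per}(x+1)=V_{\rm per}(x)$ for all $x$ and, for some $\rho\ge 0$, $V_{\rm def}(x)=0$ whenever $|x|>\rho$. Let $E>0$ and let $\Phi\in L^2(\mathbb R)$, $\Phi\neq 0$, be a bound state: $-\Phi''+V\Phi=E\Phi$. (Then $\Phi$ is either even or odd.) For $z\in\mathbb C$ let $u_z,v_z$ be the solutions of $-\psi''+V\psi=z\psi$ with $$u_z(0)=1,\ u_z'(0)=0,\quad v_z(0)=0,\ v_z'(0)=1\qquad\text{if }\Phi\text{ is even},$$ $$u_z(0)=0,\ u_z'(0)=1,\quad v_z(0)=-1,\ v_z'(0)=0\qquad\text{if }\Phi\text{ is odd}.$$ For $M>0$ and $z\in\mathbb C\setminus(-\infty,0]$ put $\Theta(z)=\Theta_M(z):=u_z'(M)-i\sqrt z\,u_z(M)$, with the principal branch of the square root. Let $k$ be the logarithm of the largest modulus of a characteristic (Floquet) multiplier of the periodic equation $-\psi''+V_{\rm per}\psi=E\psi$, i.e. of a number $\mu\in\mathbb C$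 for which this equation has a nonzero solution with $\psi(x+1)=\mu\psi(x)$ for all $x$. Then $k>0$, and there are constants $C$ and $M_0>\rho$ such that for all $M\ge M_0$ the function $\Theta$ is complex differentiable at $E$, $\partial_z\Theta(E)\ne0$, $\left[(v_E'(M))^2+E(v_E(M))^2\right]\int_0^M u_E^2(y)\,dy\neq0$, and $$\left|\frac{\Theta(E)}{\partial_z\Theta(E)}-\frac{i\sqrt E-\left[u_E'(M)v_E'(M)+E\,u_E(M)v_E(M)\right]}{\left[(v_E'(M))^2+E(v_E(M))^2\right]\int_0^M u_E^2(y)\,dy}\right|\le C\,M\,e^{-4kM}.$$ -/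

import Mathlib

/-- `ψ` is a classical (twice differentiable) solution on `ℝ` of `(D_x² + V - z) ψ = 0`,
that is, of `-ψ'' + V ψ = z ψ`. -/
def IsSchrodingerSolution (V : ℝ → ℝ) (z : ℂ) (ψ : ℝ → ℂ) : Prop :=
  Differentiable ℝ ψ ∧ Differentiable ℝ (deriv ψ) ∧
    ∀ x : ℝ, -deriv (deriv ψ) x + (V x : ℂ) * ψ x = z * ψ x

/-- `ψ` is the solution of `-ψ'' + V ψ = z ψ` with `ψ(0) = a`, `ψ'(0) = b`. -/
def IsCauchySolution (V : ℝ → ℝ) (z a b : ℂ) (ψ : ℝ → ℂ) : Prop :=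
  IsSchrodingerSolution V z ψ ∧ ψ 0 = a ∧ deriv ψ 0 = b

/-- `Φ` is a bound state of `H = D_x² + V` with energy `E`: a nonzero square-integrable
solution of `H Φ = E Φ`. -/
def IsBoundState (V : ℝ → ℝ) (E : ℝ) (Φ : ℝ → ℂ) : Prop :=
  Φ ≠ 0 ∧ MeasureTheory.MemLp Φ 2 MeasureTheory.volume ∧ IsSchrodingerSolution V (E : ℂ) Φ

/-- `u z` and `v z` are, for every `z`, the two normalized solutions attached to the bound
state `Φ`. If `Φ` is even, `u z` has Cauchy data `(1, 0)` and `v z` has `(0, 1)` at the origin;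
if `Φ` is odd, `u z` has Cauchy data `(0, 1)` and `v z` has `(-1, 0)`. -/
def IsNormalizedPair (V : ℝ → ℝ) (Φ : ℝ → ℂ) (u v : ℂ → ℝ → ℂ) : Prop :=
  (Function.Even Φ → ∀ z : ℂ, IsCauchySolution V z 1 0 (u z) ∧ IsCauchySolution V z 0 1 (v z)) ∧
  (Function.Odd Φ → ∀ z : ℂ, IsCauchySolution V z 0 1 (u z) ∧ IsCauchySolution V z (-1) 0 (v z))

/-- `Θ(z) = u_z'(M) - i √z u_z(M)`, with the principal branch of the square root. -/
noncomputable def Theta (u : ℂ → ℝ → ℂ) (M : ℝ) (z : ℂ) : ℂ :=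
  deriv (u z) M - Complex.I * z ^ (1 / 2 : ℂ) * u z M

/-- `μ` is a characteristic (Floquet) multiplier of the `1`-periodic equation
`-ψ'' + W ψ = E ψ`. -/
def IsFloquetMultiplier (W : ℝ → ℝ) (E : ℝ) (μ : ℂ) : Prop :=
  ∃ ψ : ℝ → ℂ, ψ ≠ 0 ∧ IsSchrodingerSolution W (E : ℂ) ψ ∧ ∀ x : ℝ, ψ (x + 1) = μ * ψ x

/-- The explicit first-order correction
`(i√E - [u_E'(M) v_E'(M) + E u_E(M) v_E(M)]) / ([v_E'(M)² + E v_E(M)²] ∫₀ᴹ u_E²)`. -/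
noncomputable def explicitCorrection (u v : ℂ → ℝ → ℂ) (E M : ℝ) : ℂ :=
  (Complex.I * (Real.sqrt E : ℂ)
      - (deriv (u E) M * deriv (v E) M + (E : ℂ) * u E M * v E M)) /
    ((deriv (v E) M ^ 2 + (E : ℂ) * v E M ^ 2) * ∫ y in (0 : ℝ)..M, u E y ^ 2)

/-!
By parity the Cauchy data of `Φ` at the origin are a multiple of those of `u = u_E`, so `u` decays.
Beyond `ρ` the shift by one maps solutions to solutions and preserves Wronskians; hence `u` is a
Floquet function there with a multiplier `a`, `0 < |a| < 1`, the other multiplier is `a⁻¹`, and with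
`k = log |a⁻¹|` one has `u = O(e^{-kM})` and `v = v_E = O(e^{kM})`.

Put `κ = √E` and `ℓ(ψ) = ψ'(M) - iκ ψ(M)`, so that `Θ(E) = ℓ(u)`. Variation of constants gives
`∂_z (u_z, u_z') = (∫ u v) (u, u') - (∫ u²) (v, v')` at `z = E`, whence
`∂_z Θ(E) = -ℓ(v) ∫ u² + O(M e^{-kM})`. Since `u` and `v` are real with Wronskian one,
`iκ - (u' v' + E u v) = -ℓ(u) conj ℓ(v)` and `v'² + E v² = ℓ(v) conj ℓ(v)`: the explicit correction
is exactly `-ℓ(u) / (ℓ(v) ∫ u²)`. As `|ℓ(v)|` is bounded below by a multiple of `e^{kM}`, the error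
has the order `e^{-kM} · M e^{-kM} · e^{-2kM}`.
-/

open Set Filter Topology Asymptotics MeasureTheory

/-- The curve in phase space `ℂ × ℂ` traced by a function and its derivative. -/
noncomputable def phaseCurve (ψ : ℝ → ℂ) (x : ℝ) : ℂ × ℂ := (ψ x, deriv ψ x)

/-- The Wronskian, as the symplectic form on phase space:
`wronskian (f, f') (g, g') = f g' - f' g`. -/
def wronskian (p q : ℂ × ℂ) : ℂ := p.1 * q.2 - p.2 * q.1

theorem wronskian_swap (p q : ℂ × ℂ) : wronskian q p = -wronskian p q := by
  simp only [wronskian]; ring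

theorem wronskian_self (p : ℂ × ℂ) : wronskian p p = 0 := by
  simp only [wronskian]; ring

theorem wronskian_smul_left (c : ℂ) (p q : ℂ × ℂ) :
    wronskian (c • p) q = c * wronskian p q := by
  simp only [wronskian, Prod.smul_fst, Prod.smul_snd, smul_eq_mul]; ring

theorem wronskian_smul_right (c : ℂ) (p q : ℂ × ℂ) :
    wronskian p (c • q) = c * wronskian p q := by
  simp only [wronskian, Prod.smul_fst, Prod.smul_snd, smul_eq_mul]; ring

theorem eq_wronskian_smul_add {p q : ℂ × ℂ} (hpq : wronskian p q = 1) (r : ℂ × ℂ) :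
    r = wronskian r q • p + wronskian p r • q := by
  have h : p.1 * q.2 - p.2 * q.1 = 1 := hpq
  refine Prod.ext ?_ ?_ <;>
    simp only [wronskian, Prod.fst_add, Prod.snd_add, Prod.smul_fst, Prod.smul_snd, smul_eq_mul]
  · linear_combination -r.1 * h
  · linear_combination -r.2 * h

theorem left_ne_zero_of_wronskian_eq_one {p q : ℂ × ℂ} (hpq : wronskian p q = 1) : p ≠ 0 := by
  rintro rfl
  simp [wronskian] at hpq

theorem right_ne_zero_of_wronskian_eq_one {p q : ℂ × ℂ} (hpq : wronskian p q = 1) : q ≠ 0 := by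
  rintro rfl
  simp [wronskian] at hpq

theorem norm_wronskian_le (p q : ℂ × ℂ) : ‖wronskian p q‖ ≤ 2 * (‖p‖ * ‖q‖) :=
  calc ‖wronskian p q‖ ≤ ‖p.1‖ * ‖q.2‖ + ‖p.2‖ * ‖q.1‖ := by
        simpa only [wronskian, norm_mul] using norm_sub_le (p.1 * q.2) (p.2 * q.1)
    _ ≤ ‖p‖ * ‖q‖ + ‖p‖ * ‖q‖ := by
        gcongr <;> first | exact norm_fst_le _ | exact norm_snd_le _
    _ = 2 * (‖p‖ * ‖q‖) := by ring

/-- The curve `F` in phase space solves the first-order system of `ψ'' = Q ψ` on `s`. -/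
def SolvesOn (Q : ℝ → ℂ) (F : ℝ → ℂ × ℂ) (s : Set ℝ) : Prop :=
  ∀ x ∈ s, HasDerivAt F ((F x).2, Q x * (F x).1) x

theorem IsSchrodingerSolution.solvesOn {V : ℝ → ℝ} {z : ℂ} {ψ : ℝ → ℂ}
    (h : IsSchrodingerSolution V z ψ) :
    SolvesOn (fun x => V x - z) (phaseCurve ψ) univ := by
  obtain ⟨hψ, hψ', heq⟩ := h
  intro x _
  have hQ : deriv (deriv ψ) x = (V x - z) * ψ x := by linear_combination -heq x
  exact ((hψ x).hasDerivAt.prodMk (hψ' x).hasDerivAt).congr_deriv (Prod.ext rfl hQ)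

namespace SolvesOn

variable {Q Q₁ Q₂ : ℝ → ℂ} {F G : ℝ → ℂ × ℂ} {s t : Set ℝ}

theorem mono (hF : SolvesOn Q F s) (hts : t ⊆ s) : SolvesOn Q F t :=
  fun x hx => hF x (hts hx)

theorem congr (hF : SolvesOn Q₁ F s) (hQ : EqOn Q₁ Q₂ s) : SolvesOn Q₂ F s :=
  fun x hx => hQ hx ▸ hF x hx

theorem continuousOn (hF : SolvesOn Q F s) : ContinuousOn F s :=
  fun x hx => (hF x hx).continuousAt.continuousWithinAt

theorem continuous (hF : SolvesOn Q F univ) : Continuous F :=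
  continuous_iff_continuousAt.2 fun x => (hF x (mem_univ x)).continuousAt

theorem hasDerivAt_fst {x : ℝ} (hF : SolvesOn Q F s) (hx : x ∈ s) :
    HasDerivAt (fun y => (F y).1) (F x).2 x :=
  (hF x hx).fst

theorem hasDerivAt_snd {x : ℝ} (hF : SolvesOn Q F s) (hx : x ∈ s) :
    HasDerivAt (fun y => (F y).2) (Q x * (F x).1) x :=
  (hF x hx).snd

theorem exists_fst_ne_zero {x : ℝ} (hF : SolvesOn Q F s) (hs : IsOpen s) (hx : x ∈ s)
    (hFx : F x ≠ 0) : ∃ y ∈ s, (F y).1 ≠ 0 := by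
  by_contra! h
  have hzero : (fun y => (F y).1) =ᶠ[𝓝 x] fun _ => 0 :=
    Filter.eventuallyEq_of_mem (hs.mem_nhds hx) h
  exact hFx (Prod.ext (h x hx)
    (((hF.hasDerivAt_fst hx).congr_of_eventuallyEq hzero.symm).unique (hasDerivAt_const x 0)))

theorem isSchrodingerSolution {V : ℝ → ℝ} {z : ℂ}
    (hF : SolvesOn (fun x => V x - z) F univ) :
    IsSchrodingerSolution V z fun x => (F x).1 := by
  have hd : deriv (fun x => (F x).1) = fun x => (F x).2 :=
    funext fun x => (hF.hasDerivAt_fst (mem_univ x)).deriv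
  refine ⟨fun x => (hF.hasDerivAt_fst (mem_univ x)).differentiableAt, ?_, fun x => ?_⟩
  · rw [hd]
    exact fun x => (hF.hasDerivAt_snd (mem_univ x)).differentiableAt
  · rw [hd, (hF.hasDerivAt_snd (mem_univ x)).deriv]
    ring

theorem add (hF : SolvesOn Q F s) (hG : SolvesOn Q G s) :
    SolvesOn Q (fun x => F x + G x) s := fun x hx => by
  refine ((hF x hx).add (hG x hx)).congr_deriv (Prod.ext rfl ?_)
  simp only [Prod.snd_add, Prod.fst_add]
  ring

theorem const_smul (hF : SolvesOn Q F s) (c : ℂ) : SolvesOn Q (fun x => c • F x) s := fun x hx => by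
  refine ((hF x hx).const_smul c).congr_deriv (Prod.ext rfl ?_)
  simp only [Prod.smul_snd, Prod.smul_fst, smul_eq_mul]
  ring

theorem comp_add_const {c : ℝ} (hF : SolvesOn Q F s) :
    SolvesOn (fun x => Q (x + c)) (fun x => F (x + c)) ((· + c) ⁻¹' s) := fun x hx =>
  (hF (x + c) hx).comp_add_const x c

theorem comp_neg (hF : SolvesOn Q F s) :
    SolvesOn (fun x => Q (-x)) (fun x => ((F (-x)).1, -(F (-x)).2)) (Neg.neg ⁻¹' s) :=
  fun x hx => by
  have hfst := (hF.hasDerivAt_fst hx).scomp x (hasDerivAt_neg x)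
  have hsnd := ((hF.hasDerivAt_snd hx).scomp x (hasDerivAt_neg x)).neg
  refine (hfst.prodMk hsnd).congr_deriv ?_
  simp only [neg_smul, one_smul, neg_neg]

theorem star (hF : SolvesOn Q F s) (hQ : ∀ x ∈ s, IsSelfAdjoint (Q x)) :
    SolvesOn Q (fun x => star (F x)) s := fun x hx => by
  refine (hF x hx).star.congr_deriv (Prod.ext rfl ?_)
  simp only [Prod.snd_star, Prod.fst_star, star_mul', (hQ x hx).star_eq]

theorem hasDerivAt_wronskian {x : ℝ} (hF : SolvesOn Q₁ F s) (hG : SolvesOn Q₂ G s) (hx : x ∈ s) :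
    HasDerivAt (fun y => wronskian (F y) (G y)) ((Q₂ x - Q₁ x) * ((F x).1 * (G x).1)) x := by
  have hd := ((hF.hasDerivAt_fst hx).mul (hG.hasDerivAt_snd hx)).sub
    ((hF.hasDerivAt_snd hx).mul (hG.hasDerivAt_fst hx))
  exact hd.congr_deriv (by ring)

theorem wronskian_eq {x y : ℝ} (hF : SolvesOn Q F s) (hG : SolvesOn Q G s) (hs : IsOpen s)
    (hs' : IsPreconnected s) (hx : x ∈ s) (hy : y ∈ s) :
    wronskian (F x) (G x) = wronskian (F y) (G y) := by
  have hd : ∀ w ∈ s, HasDerivAt (fun y => wronskian (F y) (G y)) 0 w := fun w hw => by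
    simpa only [sub_self, zero_mul] using hF.hasDerivAt_wronskian hG hw
  exact hs.is_const_of_deriv_eq_zero hs'
    (fun w hw => (hd w hw).differentiableAt.differentiableWithinAt)
    (fun w hw => (hd w hw).deriv) hx hy

theorem wronskian_eq_add_integral {c : ℂ} (hF : SolvesOn Q₁ F univ) (hG : SolvesOn Q₂ G univ)
    (hQ : ∀ x, Q₂ x - Q₁ x = c) (a b : ℝ) :
    wronskian (F b) (G b) = wronskian (F a) (G a) + c * ∫ x in a..b, (F x).1 * (G x).1 := by
  have hd : ∀ x, HasDerivAt (fun y => wronskian (F y) (G y)) (c * ((F x).1 * (G x).1)) x :=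
    fun x => hQ x ▸ hF.hasDerivAt_wronskian hG (mem_univ x)
  have hcont : Continuous fun x => c * ((F x).1 * (G x).1) :=
    continuous_const.mul (hF.continuous.fst.mul hG.continuous.fst)
  rw [← intervalIntegral.integral_const_mul, intervalIntegral.integral_eq_sub_of_hasDerivAt
    (fun x _ => hd x) (hcont.intervalIntegrable a b)]
  ring

theorem norm_sub_le_gronwallBound {K δ ε a b : ℝ} (hF : SolvesOn Q₁ F (Icc a b))
    (hG : SolvesOn Q₂ G (Icc a b)) (hQ : ∀ x ∈ Icc a b, ‖Q₁ x‖ ≤ K)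
    (hε : ∀ x ∈ Icc a b, ‖(Q₁ x - Q₂ x) * (G x).1‖ ≤ ε) (hδ : ‖F a - G a‖ ≤ δ) :
    ∀ x ∈ Icc a b, ‖F x - G x‖ ≤ gronwallBound δ (max 1 K) ε (x - a) := by
  refine norm_le_gronwallBound_of_norm_deriv_right_le (hF.continuousOn.sub hG.continuousOn)
    (fun x hx => ((hF x (Ico_subset_Icc_self hx)).sub
      (hG x (Ico_subset_Icc_self hx))).hasDerivWithinAt) hδ fun x hx => ?_
  have hx := Ico_subset_Icc_self hx
  have hε₀ : 0 ≤ ε := (norm_nonneg _).trans (hε x hx)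
  have hfst : ‖(F x).1 - (G x).1‖ ≤ ‖F x - G x‖ := norm_fst_le (F x - G x)
  have hsnd : ‖(F x).2 - (G x).2‖ ≤ ‖F x - G x‖ := norm_snd_le (F x - G x)
  refine max_le ?_ ?_
  · calc ‖(F x).2 - (G x).2‖ ≤ 1 * ‖F x - G x‖ := by rwa [one_mul]
      _ ≤ max 1 K * ‖F x - G x‖ + ε := by
          nlinarith [le_max_left 1 K, norm_nonneg (F x - G x)]
  · calc ‖Q₁ x * (F x).1 - Q₂ x * (G x).1‖
        = ‖Q₁ x * ((F x).1 - (G x).1) + (Q₁ x - Q₂ x) * (G x).1‖ := by ring_nf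
      _ ≤ ‖Q₁ x‖ * ‖(F x).1 - (G x).1‖ + ‖(Q₁ x - Q₂ x) * (G x).1‖ :=
          (norm_add_le _ _).trans_eq (by rw [norm_mul (Q₁ x)])
      _ ≤ max 1 K * ‖F x - G x‖ + ε := by
          gcongr
          exacts [(hQ x hx).trans (le_max_right 1 K), hε x hx]

theorem eqOn_Ici {a : ℝ} (hQ : Continuous Q) (hF : SolvesOn Q F (Ici a)) (hG : SolvesOn Q G (Ici a))
    (h : F a = G a) : EqOn F G (Ici a) := fun x hx => by
  obtain ⟨K, hK⟩ := (isCompact_Icc (a := a) (b := x)).exists_bound_of_continuousOn hQ.continuousOn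
  have hle := (hF.mono Icc_subset_Ici_self).norm_sub_le_gronwallBound (b := x) (δ := 0) (ε := 0)
    (hG.mono Icc_subset_Ici_self) hK
    (fun y _ => by simp only [sub_self, zero_mul, norm_zero, le_refl]) (by simp [h])
    x (right_mem_Icc.2 hx)
  rw [gronwallBound_ε0_δ0] at hle
  exact sub_eq_zero.1 (norm_le_zero_iff.1 hle)

theorem ext (hQ : Continuous Q) (hF : SolvesOn Q F univ) (hG : SolvesOn Q G univ)
    (h : F 0 = G 0) : F = G := by
  funext x
  rcases le_total 0 x with hx | hx
  · exact (hF.mono (subset_univ _)).eqOn_Ici hQ (hG.mono (subset_univ _)) h hx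
  · have hneg := (hF.comp_neg.mono (subset_univ _)).eqOn_Ici (hQ.comp continuous_neg)
      (hG.comp_neg.mono (subset_univ _)) (by simp only [neg_zero, h]) (neg_nonneg.2 hx)
    simpa only [neg_neg, Prod.mk.injEq, neg_inj, ← Prod.ext_iff] using hneg

theorem isSelfAdjoint (hQ : Continuous Q) (hQ' : ∀ x, IsSelfAdjoint (Q x))
    (hF : SolvesOn Q F univ) (h : IsSelfAdjoint (F 0)) (x : ℝ) : IsSelfAdjoint (F x) :=
  congrFun (SolvesOn.ext hQ (hF.star fun x _ => hQ' x) hF h) x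

end SolvesOn

section Decay

variable {E : Type*} [NormedAddCommGroup E]

theorem sq_integral_unit_interval_le {g : ℝ → ℝ} {x : ℝ} (hg : ContinuousOn g (Icc x (x + 1))) :
    (∫ y in x..x + 1, g y) ^ 2 ≤ ∫ y in x..x + 1, g y ^ 2 := by
  have hx : x ≤ x + 1 := (lt_add_one x).le
  have hg : ContinuousOn g (uIcc x (x + 1)) := uIcc_of_le hx ▸ hg
  have hg2 : IntervalIntegrable (fun y => g y ^ 2) volume x (x + 1) := (hg.pow 2).intervalIntegrable
  set m := ∫ y in x..x + 1, g y with hm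
  have hg1 : IntervalIntegrable (fun y => 2 * m * g y) volume x (x + 1) :=
    hg.intervalIntegrable.const_mul (2 * m)
  have variance : ∫ y in x..x + 1, (g y - m) ^ 2 = (∫ y in x..x + 1, g y ^ 2) - m ^ 2 :=
    calc ∫ y in x..x + 1, (g y - m) ^ 2
        = ∫ y in x..x + 1, (g y ^ 2 - 2 * m * g y + m ^ 2) := by
          congr 1 with y
          ring
      _ = (∫ y in x..x + 1, g y ^ 2) - 2 * m * m + m ^ 2 := by
          rw [intervalIntegral.integral_add (hg2.sub hg1) intervalIntegrable_const,
            intervalIntegral.integral_sub hg2 hg1, intervalIntegral.integral_const_mul, ← hm,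
            intervalIntegral.integral_const, add_sub_cancel_left, one_smul]
      _ = (∫ y in x..x + 1, g y ^ 2) - m ^ 2 := by ring
  rw [← sub_nonneg, ← variance]
  exact intervalIntegral.integral_nonneg hx fun y _ => sq_nonneg _

theorem tendsto_integral_unit_interval_zero [NormedSpace ℝ E] {g : ℝ → E} {ρ : ℝ}
    (hg : IntegrableOn g (Ioi ρ)) :
    Tendsto (fun x => ∫ y in x..x + 1, g y) atTop (𝓝 0) := by
  have hlim := intervalIntegral_tendsto_integral_Ioi ρ hg tendsto_id
  have hlim' := intervalIntegral_tendsto_integral_Ioi ρ hg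
    (tendsto_atTop_add_const_right atTop 1 tendsto_id)
  have hint : ∀ x, ρ < x → IntervalIntegrable g volume ρ x := fun x hx =>
    (intervalIntegrable_iff_integrableOn_Ioc_of_le hx.le).2 (hg.mono_set Ioc_subset_Ioi_self)
  rw [← sub_self (∫ y in Ioi ρ, g y)]
  refine (hlim'.sub hlim).congr' ?_
  filter_upwards [eventually_gt_atTop ρ] with x hx
  exact intervalIntegral.integral_interval_sub_left (hint _ (hx.trans (lt_add_one x))) (hint x hx)

theorem tendsto_integral_norm_unit_interval_zero {f : ℝ → E} {ρ : ℝ} (hf : ContinuousOn f (Ioi ρ))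
    (hf2 : MemLp f 2 (volume.restrict (Ioi ρ))) :
    Tendsto (fun x => ∫ y in x..x + 1, ‖f y‖) atTop (𝓝 0) := by
  have hsq := (tendsto_integral_unit_interval_zero (hf2.integrable_norm_pow two_ne_zero)).sqrt
  rw [Real.sqrt_zero] at hsq
  refine squeeze_zero' (.of_forall fun x => intervalIntegral.integral_nonneg (lt_add_one x).le
    fun y _ => norm_nonneg _) ?_ hsq
  filter_upwards [eventually_gt_atTop ρ] with x hx
  exact Real.le_sqrt_of_sq_le (sq_integral_unit_interval_le
    (hf.norm.mono fun y hy => hx.trans_le hy.1))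

variable [NormedSpace ℝ E] [CompleteSpace E]

theorem integral_smul_sub_smul_eq_sub {η η' η'' : ℝ → ℝ} {f f' f'' : ℝ → E}
    {a b : ℝ} (hη : ∀ y, HasDerivAt η (η' y) y) (hη' : ∀ y, HasDerivAt η' (η'' y) y)
    (hη'' : Continuous η'') (hf : ∀ y ∈ uIcc a b, HasDerivAt f (f' y) y)
    (hf' : ∀ y ∈ uIcc a b, HasDerivAt f' (f'' y) y) (hf'' : ContinuousOn f'' (uIcc a b)) :
    ∫ y in a..b, (η y • f'' y - η'' y • f y) =
      (η b • f' b - η' b • f b) - (η a • f' a - η' a • f a) := by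
  have hηcont : Continuous η := continuous_iff_continuousAt.2 fun y => (hη y).continuousAt
  have hfcont : ContinuousOn f (uIcc a b) := fun y hy => (hf y hy).continuousAt.continuousWithinAt
  refine intervalIntegral.integral_eq_sub_of_hasDerivAt (f := fun y => η y • f' y - η' y • f y)
    (fun y hy => ?_) ((hηcont.continuousOn.smul hf'').sub
      (hη''.continuousOn.smul hfcont)).intervalIntegrable
  refine (((hη y).smul (hf' y hy)).sub ((hη' y).smul (hf y hy))).congr_deriv ?_
  abel

theorem norm_boundary_le_integral_norm {η η' η'' : ℝ → ℝ} {f f' f'' : ℝ → E}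
    {x A B : ℝ} (hη : ∀ y, HasDerivAt η (η' y) y) (hη' : ∀ y, HasDerivAt η' (η'' y) y)
    (hη'' : Continuous η'') (hη1 : η 1 = 0) (hη1' : η' 1 = 0)
    (hA : ∀ t ∈ Icc (0 : ℝ) 1, |η t| ≤ A) (hB : ∀ t ∈ Icc (0 : ℝ) 1, |η'' t| ≤ B)
    (hf : ∀ y ∈ Icc x (x + 1), HasDerivAt f (f' y) y)
    (hf' : ∀ y ∈ Icc x (x + 1), HasDerivAt f' (f'' y) y)
    (hf'' : ContinuousOn f'' (Icc x (x + 1))) :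
    ‖η 0 • f' x - η' 0 • f x‖ ≤
      A * (∫ y in x..x + 1, ‖f'' y‖) + B * ∫ y in x..x + 1, ‖f y‖ := by
  have hx : x ≤ x + 1 := (lt_add_one x).le
  have huIcc : uIcc x (x + 1) = Icc x (x + 1) := uIcc_of_le hx
  have hfcont : ContinuousOn f (Icc x (x + 1)) :=
    fun y hy => (hf y hy).continuousAt.continuousWithinAt
  have hint : ∀ {g : ℝ → E}, ContinuousOn g (Icc x (x + 1)) →
      IntervalIntegrable (fun y => ‖g y‖) volume x (x + 1) := fun hg =>
    (huIcc ▸ hg.norm : ContinuousOn _ (uIcc x (x + 1))).intervalIntegrable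
  have green := integral_smul_sub_smul_eq_sub (η := fun y => η (y - x)) (η' := fun y => η' (y - x))
    (fun y => (hη (y - x)).comp_sub_const y x) (fun y => (hη' (y - x)).comp_sub_const y x)
    (hη''.comp (continuous_sub_right x)) (huIcc ▸ hf) (huIcc ▸ hf') (huIcc ▸ hf'')
  simp only [add_sub_cancel_left, sub_self, hη1, hη1', zero_smul, zero_sub] at green
  rw [← norm_neg, ← green, ← intervalIntegral.integral_const_mul,
    ← intervalIntegral.integral_const_mul, ← intervalIntegral.integral_add
      ((hint hf'').const_mul A) ((hint hfcont).const_mul B)]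
  refine intervalIntegral.norm_integral_le_of_norm_le hx (ae_of_all _ fun y hy => ?_)
    (((hint hf'').const_mul A).add ((hint hfcont).const_mul B))
  have hy : y - x ∈ Icc (0 : ℝ) 1 := ⟨by linarith [hy.1], by linarith [hy.2]⟩
  refine (norm_sub_le _ _).trans ?_
  rw [norm_smul, norm_smul, Real.norm_eq_abs, Real.norm_eq_abs]
  gcongr
  exacts [hA _ hy, hB _ hy]

theorem norm_prod_le_integral_norm {f f' f'' : ℝ → E} {x : ℝ}
    (hf : ∀ y ∈ Icc x (x + 1), HasDerivAt f (f' y) y)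
    (hf' : ∀ y ∈ Icc x (x + 1), HasDerivAt f' (f'' y) y)
    (hf'' : ContinuousOn f'' (Icc x (x + 1))) :
    ‖(f x, f' x)‖ ≤ 1 * (∫ y in x..x + 1, ‖f'' y‖) + 6 * ∫ y in x..x + 1, ‖f y‖ := by
  -- Cubics `η` with `η(1) = η'(1) = 0`; the pairs `(η(0), η'(0)) = (0, 1)` and `(1, 0)`
  -- isolate `f x` and `f' x`.
  let η (b c t : ℝ) : ℝ := (1 - t) ^ 2 * (b + c * t)
  let η' (b c t : ℝ) : ℝ := c * (1 - t) ^ 2 - 2 * (1 - t) * (b + c * t)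
  let η'' (b c t : ℝ) : ℝ := 2 * (b + c * t) - 4 * c * (1 - t)
  have hη (b c t : ℝ) : HasDerivAt (η b c) (η' b c t) t := by
    refine ((((hasDerivAt_id' t).const_sub 1).fun_pow 2).mul
      (((hasDerivAt_id' t).const_mul c).const_add b)).congr_deriv ?_
    simp only [η']
    ring
  have hη' (b c t : ℝ) : HasDerivAt (η' b c) (η'' b c t) t := by
    refine (((((hasDerivAt_id' t).const_sub 1).fun_pow 2).const_mul c).sub
      ((((hasDerivAt_id' t).const_sub 1).const_mul 2).mul
        (((hasDerivAt_id' t).const_mul c).const_add b))).congr_deriv ?_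
    simp only [η'']
    ring
  have bound (b c : ℝ) (hA : ∀ t ∈ Icc (0 : ℝ) 1, |η b c t| ≤ 1)
      (hB : ∀ t ∈ Icc (0 : ℝ) 1, |η'' b c t| ≤ 6) :=
    norm_boundary_le_integral_norm (hη b c) (hη' b c) (by fun_prop) (by simp [η]) (by simp [η'])
      hA hB hf hf' hf''
  refine max_le ?_ ?_
  · have h := bound 0 1
      (fun t ⟨h₀, h₁⟩ => by
        rw [abs_of_nonneg (by positivity)]
        nlinarith [pow_le_one₀ (n := 2) (sub_nonneg.2 h₁) (sub_le_self 1 h₀)])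
      fun t ⟨h₀, h₁⟩ => abs_le.2 ⟨by linarith, by linarith⟩
    simpa [η, η'] using h
  · have h := bound 1 2
      (fun t ⟨h₀, h₁⟩ => by
        rw [abs_of_nonneg (by positivity)]
        nlinarith [mul_nonneg (sub_nonneg.2 h₁) (sq_nonneg t), sq_nonneg t])
      fun t ⟨h₀, h₁⟩ => abs_le.2 ⟨by linarith, by linarith⟩
    simpa [η, η'] using h

end Decay

theorem SolvesOn.tendsto_zero {Q : ℝ → ℂ} {F : ℝ → ℂ × ℂ} {ρ : ℝ} (hQ : ContinuousOn Q (Ioi ρ))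
    (hQb : Q =O[atTop] fun _ => (1 : ℝ)) (hF : SolvesOn Q F (Ioi ρ))
    (hF2 : MemLp (fun x => (F x).1) 2 (volume.restrict (Ioi ρ))) : Tendsto F atTop (𝓝 0) := by
  have hfst : ContinuousOn (fun x => (F x).1) (Ioi ρ) :=
    continuous_fst.comp_continuousOn hF.continuousOn
  obtain ⟨K, hK⟩ := hQb.bound
  simp only [norm_one, mul_one] at hK
  obtain ⟨R, hR⟩ := eventually_atTop.1 hK
  have hlim := (tendsto_integral_norm_unit_interval_zero hfst hF2).const_mul (K + 6)
  rw [mul_zero] at hlim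
  refine squeeze_zero_norm' ?_ hlim
  filter_upwards [eventually_gt_atTop ρ, eventually_ge_atTop R] with x hρx hRx
  have hsub : Icc x (x + 1) ⊆ Ioi ρ := fun y hy => hρx.trans_le hy.1
  have hx : x ≤ x + 1 := (lt_add_one x).le
  have hu : uIcc x (x + 1) ⊆ Ioi ρ := uIcc_of_le hx ▸ hsub
  have hQF : ‖F x‖ ≤ 1 * (∫ y in x..x + 1, ‖Q y * (F y).1‖) + 6 * ∫ y in x..x + 1, ‖(F y).1‖ :=
    norm_prod_le_integral_norm (fun y hy => hF.hasDerivAt_fst (hsub hy))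
      (fun y hy => hF.hasDerivAt_snd (hsub hy)) ((hQ.mul hfst).mono hsub)
  have hQint : ∫ y in x..x + 1, ‖Q y * (F y).1‖ ≤ K * ∫ y in x..x + 1, ‖(F y).1‖ := by
    rw [← intervalIntegral.integral_const_mul]
    refine intervalIntegral.integral_mono_on hx ((hQ.mul hfst).norm.mono hu).intervalIntegrable
      ((hfst.norm.mono hu).intervalIntegrable.const_mul K) fun y hy => ?_
    rw [norm_mul]
    gcongr
    exact hR y (hRx.trans hy.1)
  linarith

/-- `F` is a Floquet function on the half-line `(ρ, ∞)`: a unit shift multiplies it by `a`.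
For `a = 1` this is `1`-periodicity beyond `ρ`. -/
def HasMultiplierOnIoi {E : Type*} [SMul ℂ E] (a : ℂ) (ρ : ℝ) (F : ℝ → E) : Prop :=
  ∀ x, ρ < x → F (x + 1) = a • F x

namespace HasMultiplierOnIoi

variable {E : Type*} [NormedAddCommGroup E] [NormedSpace ℂ E] {F : ℝ → E} {a : ℂ} {ρ : ℝ}

theorem apply_add_natCast (h : HasMultiplierOnIoi a ρ F) {x : ℝ} (hx : ρ < x) (n : ℕ) :
    F (x + n) = a ^ n • F x := by
  induction n with
  | zero => simp only [Nat.cast_zero, add_zero, pow_zero, one_smul]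
  | succ n ih =>
    rw [Nat.cast_succ, ← add_assoc, h _ (hx.trans_le (le_add_of_nonneg_right n.cast_nonneg)), ih,
      pow_succ', mul_smul]

theorem isBigO_exp (h : HasMultiplierOnIoi a ρ F) (ha : a ≠ 0) (hF : ContinuousOn F (Ioi ρ)) :
    F =O[atTop] fun x => Real.exp (Real.log ‖a‖ * x) := by
  have hcont : ContinuousOn (fun x : ℝ => Real.exp (-(Real.log ‖a‖ * x)) * ‖F x‖)
      (Icc (ρ + 1) (ρ + 2)) :=
    (by fun_prop : Continuous fun x : ℝ => Real.exp (-(Real.log ‖a‖ * x))).continuousOn.mul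
      (hF.norm.mono fun x hx => (lt_add_one ρ).trans_le hx.1)
  obtain ⟨B, hB⟩ := isCompact_Icc.exists_bound_of_continuousOn hcont
  refine IsBigO.of_bound B ?_
  filter_upwards [eventually_ge_atTop (ρ + 1)] with x hx
  set n := ⌊x - (ρ + 1)⌋₊
  have hn : (n : ℝ) ≤ x - (ρ + 1) := Nat.floor_le (sub_nonneg.2 hx)
  have hn' : x - (ρ + 1) < n + 1 := Nat.lt_floor_add_one _
  have hshift : ‖F x‖ = Real.exp (Real.log ‖a‖ * n) * ‖F (x - n)‖ := by
    have hFx := h.apply_add_natCast (x := x - n) (by linarith) n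
    rw [sub_add_cancel] at hFx
    rw [hFx, norm_smul, norm_pow, mul_comm (Real.log _), Real.exp_nat_mul,
      Real.exp_log (norm_pos_iff.2 ha)]
  have hbound := (le_abs_self _).trans (hB (x - n) ⟨by linarith, by linarith⟩)
  calc ‖F x‖ = Real.exp (-(Real.log ‖a‖ * (x - n))) * ‖F (x - n)‖ *
        Real.exp (Real.log ‖a‖ * x) := by
        rw [hshift, mul_right_comm, ← Real.exp_add]
        ring_nf
    _ ≤ B * ‖Real.exp (Real.log ‖a‖ * x)‖ := by
        rw [Real.norm_of_nonneg (Real.exp_pos _).le]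
        gcongr

theorem norm_lt_one (h : HasMultiplierOnIoi a ρ F) (hlim : Tendsto F atTop (𝓝 0)) {x : ℝ}
    (hx : ρ < x) (hFx : F x ≠ 0) : ‖a‖ < 1 := by
  by_contra! ha
  have hle : ∀ n : ℕ, ‖F x‖ ≤ ‖F (x + n)‖ := fun n => by
    rw [h.apply_add_natCast hx, norm_smul, norm_pow]
    exact le_mul_of_one_le_left (norm_nonneg _) (one_le_pow₀ ha)
  have hlim' : Tendsto (fun n : ℕ => ‖F (x + n)‖) atTop (𝓝 0) :=
    tendsto_zero_iff_norm_tendsto_zero.1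
      (hlim.comp (tendsto_atTop_add_const_left _ x tendsto_natCast_atTop_atTop))
  exact hFx (norm_le_zero_iff.1 (ge_of_tendsto' hlim' hle))

theorem exists_extension (h : HasMultiplierOnIoi a ρ F) (ha : a ≠ 0) :
    ∃ G : ℝ → E, ∀ (n : ℕ) (x : ℝ), ρ < x + n → G x = (a ^ n)⁻¹ • F (x + n) := by
  refine ⟨fun x => (a ^ (⌊ρ - x⌋₊ + 1))⁻¹ • F (x + ↑(⌊ρ - x⌋₊ + 1)), fun n x hn => ?_⟩
  have hmin : ρ < x + ↑(⌊ρ - x⌋₊ + 1) := by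
    push_cast
    linarith [Nat.lt_floor_add_one (ρ - x)]
  beta_reduce
  generalize ⌊ρ - x⌋₊ + 1 = m at hmin ⊢
  rw [inv_smul_eq_iff₀ (pow_ne_zero m ha), smul_comm, eq_inv_smul_iff₀ (pow_ne_zero n ha),
    ← h.apply_add_natCast hmin, ← h.apply_add_natCast hn, add_right_comm]

end HasMultiplierOnIoi

namespace SolvesOn

variable {Q : ℝ → ℂ} {F G : ℝ → ℂ × ℂ} {ρ : ℝ} {a : ℂ}

theorem wronskian_eq_zero_of_tendsto (hF : SolvesOn Q F (Ioi ρ)) (hG : SolvesOn Q G (Ioi ρ))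
    (hF0 : Tendsto F atTop (𝓝 0)) (hG0 : Tendsto G atTop (𝓝 0)) {x : ℝ} (hx : ρ < x) :
    wronskian (F x) (G x) = 0 := by
  have hlim : Tendsto (fun y => wronskian (F y) (G y)) atTop (𝓝 0) := by
    refine squeeze_zero_norm (fun y => norm_wronskian_le _ _) ?_
    simpa only [norm_zero, mul_zero] using (hF0.norm.mul hG0.norm).const_mul 2
  refine tendsto_nhds_unique (tendsto_const_nhds.congr' ?_) hlim
  filter_upwards [eventually_gt_atTop ρ] with y hy
  exact hF.wronskian_eq hG isOpen_Ioi isPreconnected_Ioi hx hy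

theorem comp_add_one (hQ : HasMultiplierOnIoi 1 ρ Q) (hF : SolvesOn Q F (Ioi ρ)) :
    SolvesOn Q (fun x => F (x + 1)) (Ioi ρ) :=
  (hF.comp_add_const.mono fun _ hx => lt_add_of_lt_of_pos (mem_Ioi.1 hx) one_pos).congr
    fun x hx => (hQ x hx).trans (one_smul ℂ _)

theorem exists_hasMultiplierOnIoi (hQ : HasMultiplierOnIoi 1 ρ Q) (hF : SolvesOn Q F (Ioi ρ))
    (hG : SolvesOn Q G (Ioi ρ)) (hFG : ∀ x, ρ < x → wronskian (F x) (G x) = 1)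
    (hF0 : Tendsto F atTop (𝓝 0)) : ∃ a, HasMultiplierOnIoi a ρ F := by
  have hTF := hF.comp_add_one hQ
  refine ⟨wronskian (F (ρ + 1 + 1)) (G (ρ + 1)), fun x hx => ?_⟩
  have hFTF := hF.wronskian_eq_zero_of_tendsto hTF hF0
    (hF0.comp (tendsto_atTop_add_const_right _ 1 tendsto_id)) hx
  rw [eq_wronskian_smul_add (hFG x hx) (F (x + 1)), hFTF, zero_smul, add_zero,
    hTF.wronskian_eq hG isOpen_Ioi isPreconnected_Ioi hx (lt_add_one ρ)]

theorem exists_hasMultiplierOnIoi_inv (hQ : HasMultiplierOnIoi 1 ρ Q) (hG : SolvesOn Q G (Ioi ρ))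
    (hFG : ∀ x, ρ < x → wronskian (F x) (G x) = 1) (hFa : HasMultiplierOnIoi a ρ F)
    (ha : a⁻¹ ≠ a) :
    ∃ s : ℂ, HasMultiplierOnIoi a⁻¹ ρ fun x => G x + s • F x := by
  have hTG := hG.comp_add_one hQ
  set b := wronskian (G (ρ + 1 + 1)) (G (ρ + 1))
  have ha' : a⁻¹ - a ≠ 0 := sub_ne_zero.2 ha
  refine ⟨b / (a⁻¹ - a), fun x hx => ?_⟩
  have hdet : wronskian (F x) (G (x + 1)) = a⁻¹ := by
    refine eq_inv_of_mul_eq_one_right ?_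
    rw [← wronskian_smul_left, ← hFa x hx, hFG _ (lt_add_of_lt_of_pos hx one_pos)]
  have hTGx : G (x + 1) = b • F x + a⁻¹ • G x := by
    rw [eq_wronskian_smul_add (hFG x hx) (G (x + 1)), hdet,
      hTG.wronskian_eq hG isOpen_Ioi isPreconnected_Ioi hx (lt_add_one ρ)]
  have hs : b + b / (a⁻¹ - a) * a = a⁻¹ * (b / (a⁻¹ - a)) := by
    linear_combination -div_mul_cancel₀ b ha'
  beta_reduce
  rw [hTGx, hFa x hx, smul_add, smul_smul, smul_smul, ← hs]
  module

theorem mul_eq_one_or_wronskian_eq_zero {b : ℂ} (hF : SolvesOn Q F (Ioi ρ))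
    (hG : SolvesOn Q G (Ioi ρ)) (hFa : HasMultiplierOnIoi a ρ F) (hGb : HasMultiplierOnIoi b ρ G)
    {x : ℝ} (hx : ρ < x) : a * b = 1 ∨ wronskian (F x) (G x) = 0 := by
  have hconst := hF.wronskian_eq hG isOpen_Ioi isPreconnected_Ioi
    (show x + 1 ∈ Ioi ρ from hx.trans (lt_add_one x)) hx
  rwa [hFa x hx, hGb x hx, wronskian_smul_left, wronskian_smul_right, ← mul_assoc,
    mul_left_eq_self₀] at hconst

theorem exists_hasMultiplierOnIoi_pair (hQ : HasMultiplierOnIoi 1 ρ Q) (hF : SolvesOn Q F (Ioi ρ))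
    (hG : SolvesOn Q G (Ioi ρ)) (hFG : ∀ x, ρ < x → wronskian (F x) (G x) = 1)
    (hF0 : Tendsto F atTop (𝓝 0)) :
    ∃ a s : ℂ, a ≠ 0 ∧ ‖a‖ < 1 ∧ HasMultiplierOnIoi a ρ F ∧
      HasMultiplierOnIoi a⁻¹ ρ fun x => G x + s • F x := by
  obtain ⟨a, hFa⟩ := hF.exists_hasMultiplierOnIoi hQ hG hFG hF0
  have hFne : ∀ x, ρ < x → F x ≠ 0 := fun x hx =>
    left_ne_zero_of_wronskian_eq_one (hFG x hx)
  have ha : a ≠ 0 := fun h => hFne (ρ + 1 + 1) (by linarith)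
    ((hFa (ρ + 1) (lt_add_one ρ)).trans (h ▸ zero_smul ℂ _))
  have ha_lt : ‖a‖ < 1 := hFa.norm_lt_one hF0 (lt_add_one ρ) (hFne _ (lt_add_one ρ))
  have ha_lt' : 1 < ‖a⁻¹‖ := norm_inv a ▸ (one_lt_inv₀ (norm_pos_iff.2 ha)).2 ha_lt
  obtain ⟨s, hHa⟩ := hG.exists_hasMultiplierOnIoi_inv hQ hFG hFa fun h =>
    (h ▸ ha_lt').not_gt ha_lt
  exact ⟨a, s, ha, ha_lt, hFa, hHa⟩

theorem isFloquetMultiplier {W : ℝ → ℝ} {E : ℝ} (hW : ∀ x, W (x + 1) = W x)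
    (hF : SolvesOn (fun x => W x - E) F (Ioi ρ)) (hFa : HasMultiplierOnIoi a ρ F) (ha : a ≠ 0)
    {x₀ : ℝ} (hx₀ : ρ < x₀) (hFx₀ : F x₀ ≠ 0) : IsFloquetMultiplier W E a := by
  obtain ⟨G, hG⟩ := hFa.exists_extension ha
  have hGa : ∀ x, G (x + 1) = a • G x := fun x => by
    obtain ⟨n, hn⟩ := exists_nat_gt (ρ - x)
    rw [hG n (x + 1) (by linarith), hG (n + 1) x (by push_cast; linarith), smul_smul, pow_succ,
      mul_inv_rev, mul_inv_cancel_left₀ ha]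
    push_cast
    ring_nf
  have hGsol : SolvesOn (fun x => W x - E) G univ := fun x _ => by
    obtain ⟨n, hn⟩ := exists_nat_gt (ρ - x)
    have hGn : G =ᶠ[𝓝 x] fun y => (a ^ n)⁻¹ • F (y + n) := by
      filter_upwards [eventually_gt_nhds (show ρ - n < x by linarith)] with y hy
      exact hG n y (by linarith)
    have hFn := (hF.comp_add_const (c := n)).const_smul (a ^ n)⁻¹ x
      (by simpa using sub_lt_comm.1 hn)
    have hWn : W (x + n) = W x := by simpa using (show Function.Periodic W 1 from hW).nat_mul n x
    simpa only [hWn, hGn.eq_of_nhds] using hFn.congr_of_eventuallyEq hGn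
  have hGx₀ : G x₀ = F x₀ := by simpa using hG 0 x₀ (by simpa using hx₀)
  obtain ⟨y, _, hy⟩ := hGsol.exists_fst_ne_zero isOpen_univ (mem_univ x₀) (hGx₀ ▸ hFx₀)
  exact ⟨fun x => (G x).1, fun hψ => hy (congrFun hψ y), hGsol.isSchrodingerSolution,
    fun x => congrArg Prod.fst (hGa x)⟩

end SolvesOn

theorem phaseCurve_add_one {ψ : ℝ → ℂ} {μ : ℂ} (hψ : ∀ x, ψ (x + 1) = μ * ψ x) (x : ℝ) :
    phaseCurve ψ (x + 1) = μ • phaseCurve ψ x := by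
  refine Prod.ext (hψ x) ?_
  calc deriv ψ (x + 1) = deriv (fun y => ψ (y + 1)) x := (deriv_comp_add_const ψ 1 x).symm
    _ = μ * deriv ψ x := by rw [funext hψ, deriv_const_mul_field]

theorem IsFloquetMultiplier.eq_inv_or_eq {W : ℝ → ℝ} {E ρ : ℝ} {a μ : ℂ} {F G : ℝ → ℂ × ℂ}
    (hμ : IsFloquetMultiplier W E μ) (hF : SolvesOn (fun x => W x - E) F (Ioi ρ))
    (hG : SolvesOn (fun x => W x - E) G (Ioi ρ)) (hFG : ∀ x, ρ < x → wronskian (F x) (G x) = 1)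
    (hFa : HasMultiplierOnIoi a ρ F) (hGa : HasMultiplierOnIoi a⁻¹ ρ G) : μ = a⁻¹ ∨ μ = a := by
  obtain ⟨ψ, hψ0, hψ, hψμ⟩ := hμ
  have hΨ := hψ.solvesOn.mono (subset_univ (Ioi ρ))
  have hΨμ : HasMultiplierOnIoi μ ρ (phaseCurve ψ) := fun x _ => phaseCurve_add_one hψμ x
  by_contra! hne
  have hΨ0 : ∀ x, ρ < x → phaseCurve ψ x = 0 := fun x hx => by
    have hF0 := (hF.mul_eq_one_or_wronskian_eq_zero hΨ hFa hΨμ hx).resolve_left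
      fun h => hne.1 (eq_inv_of_mul_eq_one_right h)
    have hG0 := (hΨ.mul_eq_one_or_wronskian_eq_zero hG hΨμ hGa hx).resolve_left
      fun h => hne.2 (inv_inv a ▸ eq_inv_of_mul_eq_one_left h)
    rw [eq_wronskian_smul_add (hFG x hx) (phaseCurve ψ x), hF0, hG0, zero_smul, zero_smul, add_zero]
  have hμ0 : μ ≠ 0 := fun h => hψ0 <| funext fun x => by simpa [h] using hψμ (x - 1)
  refine hψ0 <| funext fun x => ?_
  obtain ⟨n, hn⟩ := exists_nat_gt (ρ - x)
  have hψμ' : HasMultiplierOnIoi μ (x - 1) ψ := fun y _ => hψμ y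
  have hxn : ψ (x + n) = μ ^ n * ψ x := hψμ'.apply_add_natCast (sub_one_lt x) n
  have h0 : ψ (x + n) = 0 := congrArg Prod.fst (hΨ0 (x + n) (by linarith))
  exact (mul_eq_zero.1 (hxn.symm.trans h0)).resolve_left (pow_ne_zero n hμ0)

theorem isGreatest_norm_isFloquetMultiplier {W : ℝ → ℝ} {E ρ : ℝ} {a : ℂ} {F G : ℝ → ℂ × ℂ}
    (hW : ∀ x, W (x + 1) = W x) (hF : SolvesOn (fun x => W x - E) F (Ioi ρ))
    (hG : SolvesOn (fun x => W x - E) G (Ioi ρ)) (hFG : ∀ x, ρ < x → wronskian (F x) (G x) = 1)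
    (hFa : HasMultiplierOnIoi a ρ F) (hGa : HasMultiplierOnIoi a⁻¹ ρ G) (ha : a ≠ 0)
    (ha_lt : ‖a‖ < 1) :
    IsGreatest {r : ℝ | ∃ μ : ℂ, IsFloquetMultiplier W E μ ∧ r = ‖μ‖} ‖a⁻¹‖ := by
  have hGne : G (ρ + 1) ≠ 0 := right_ne_zero_of_wronskian_eq_one (hFG _ (lt_add_one ρ))
  have hinv : 1 < ‖a⁻¹‖ := norm_inv a ▸ (one_lt_inv₀ (norm_pos_iff.2 ha)).2 ha_lt
  refine ⟨⟨a⁻¹, hG.isFloquetMultiplier hW hGa (inv_ne_zero ha) (lt_add_one ρ) hGne, rfl⟩, ?_⟩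
  rintro _ ⟨μ, hμ, rfl⟩
  rcases hμ.eq_inv_or_eq hF hG hFG hFa hGa with rfl | rfl
  exacts [le_rfl, (ha_lt.trans hinv).le]

theorem exists_isGreatest_norm_isFloquetMultiplier {W : ℝ → ℝ} {E ρ : ℝ} {F G : ℝ → ℂ × ℂ}
    (hW : ∀ x, W (x + 1) = W x) (hF : SolvesOn (fun x => W x - E) F (Ioi ρ))
    (hG : SolvesOn (fun x => W x - E) G (Ioi ρ)) (hFG : ∀ x, ρ < x → wronskian (F x) (G x) = 1)
    (hF0 : Tendsto F atTop (𝓝 0)) :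
    ∃ k : ℝ, 0 < k ∧
      IsGreatest {r : ℝ | ∃ μ : ℂ, IsFloquetMultiplier W E μ ∧ r = ‖μ‖} (Real.exp k) ∧
      (F =O[atTop] fun x => Real.exp (-k * x)) ∧ G =O[atTop] fun x => Real.exp (k * x) := by
  have hQ : HasMultiplierOnIoi 1 ρ fun x => (W x - E : ℂ) := fun x _ => by simp only [hW, one_smul]
  obtain ⟨a, s, ha, ha_lt, hFa, hHa⟩ := hF.exists_hasMultiplierOnIoi_pair hQ hG hFG hF0
  have hH := hG.add (hF.const_smul s)
  have hFH : ∀ x, ρ < x → wronskian (F x) (G x + s • F x) = 1 := fun x hx => by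
    rw [← hFG x hx]
    simp only [wronskian, Prod.fst_add, Prod.snd_add, Prod.smul_fst, Prod.smul_snd, smul_eq_mul]
    ring
  have hk : 0 < Real.log ‖a⁻¹‖ := by
    rw [norm_inv, Real.log_inv]
    exact neg_pos.2 (Real.log_neg (norm_pos_iff.2 ha) ha_lt)
  have hFO : F =O[atTop] fun x => Real.exp (-Real.log ‖a⁻¹‖ * x) := by
    simpa only [norm_inv, Real.log_inv, neg_neg] using hFa.isBigO_exp ha hF.continuousOn
  have hHO := hHa.isBigO_exp (inv_ne_zero ha) hH.continuousOn
  have hexp : (fun x => Real.exp (-Real.log ‖a⁻¹‖ * x)) =O[atTop]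
      fun x => Real.exp (Real.log ‖a⁻¹‖ * x) := by
    refine .of_norm_eventuallyLE ?_
    filter_upwards [eventually_ge_atTop 0] with x hx
    rw [Real.norm_of_nonneg (Real.exp_pos _).le]
    gcongr
    linarith
  refine ⟨Real.log ‖a⁻¹‖, hk, ?_, hFO, ?_⟩
  · rw [Real.exp_log (norm_pos_iff.2 (inv_ne_zero ha))]
    exact isGreatest_norm_isFloquetMultiplier hW hF hH hFH hFa hHa ha ha_lt
  · simpa only [Pi.smul_apply, add_sub_cancel_right] using
      hHO.sub ((hFO.const_smul_left s).trans hexp)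

namespace IsBoundState

variable {V : ℝ → ℝ} {E : ℝ} {Φ : ℝ → ℂ}

theorem tendsto_phaseCurve (hΦ : IsBoundState V E Φ) (hV : Continuous V)
    (hVb : (fun x => (V x - E : ℂ)) =O[atTop] fun _ => (1 : ℝ)) :
    Tendsto (phaseCurve Φ) atTop (𝓝 0) :=
  (hΦ.2.2.solvesOn.mono (subset_univ (Ioi 0))).tendsto_zero (by fun_prop) hVb
    (hΦ.2.1.restrict (Ioi 0))

theorem phaseCurve_zero_ne_zero (hΦ : IsBoundState V E Φ) (hV : Continuous V) :
    phaseCurve Φ 0 ≠ 0 := fun h => by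
  have hzero : SolvesOn (fun x => V x - E) (fun _ => 0) univ := fun x _ =>
    (hasDerivAt_const x 0).congr_deriv (Prod.ext rfl (mul_zero _).symm)
  have hΦ0 := SolvesOn.ext (by fun_prop) hΦ.2.2.solvesOn hzero h
  exact hΦ.1 (funext fun x => congrArg Prod.fst (congrFun hΦ0 x))

theorem comp_neg (hΦ : IsBoundState V E Φ) (heven : Function.Even V) :
    IsBoundState V E fun x => Φ (-x) := by
  refine ⟨fun h => hΦ.1 ?_,
    hΦ.2.1.comp_measurePreserving (Measure.measurePreserving_neg volume), ?_⟩
  · funext x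
    simpa using congrFun h (-x)
  · exact SolvesOn.isSchrodingerSolution (hΦ.2.2.solvesOn.comp_neg.congr fun x _ => by
      simp only [heven x])

theorem even_or_odd (hΦ : IsBoundState V E Φ) (hV : Continuous V) (heven : Function.Even V)
    (hVb : (fun x => (V x - E : ℂ)) =O[atTop] fun _ => (1 : ℝ)) :
    Function.Even Φ ∨ Function.Odd Φ := by
  have hR := hΦ.comp_neg heven
  have hR0 : phaseCurve (fun x => Φ (-x)) 0 = (Φ 0, -deriv Φ 0) := by
    simp only [phaseCurve, deriv_comp_neg, neg_zero]
  have hQ : Continuous fun x => (V x - E : ℂ) := by fun_prop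
  have hwronskian : wronskian (phaseCurve Φ 0) (phaseCurve (fun x => Φ (-x)) 0) = 0 :=
    (hΦ.2.2.solvesOn.mono (subset_univ (Ioi (-1)))).wronskian_eq_zero_of_tendsto
      (hR.2.2.solvesOn.mono (subset_univ _)) (hΦ.tendsto_phaseCurve hV hVb)
      (hR.tendsto_phaseCurve hV hVb) (by norm_num)
  have hprod : Φ 0 * deriv Φ 0 = 0 := by
    rw [hR0] at hwronskian
    simp only [wronskian, phaseCurve] at hwronskian
    linear_combination -hwronskian / 2
  rcases mul_eq_zero.1 hprod with h | h
  · right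
    have hcurve := SolvesOn.ext hQ hR.2.2.solvesOn (hΦ.2.2.solvesOn.const_smul (-1))
      (by rw [hR0]; simp [phaseCurve, h])
    exact fun x => by simpa [phaseCurve] using congrArg Prod.fst (congrFun hcurve x)
  · left
    have hcurve := SolvesOn.ext hQ hR.2.2.solvesOn hΦ.2.2.solvesOn
      (by rw [hR0]; simp [phaseCurve, h])
    exact fun x => congrArg Prod.fst (congrFun hcurve x)

end IsBoundState

/-- The phase curves `U z` of the solutions of `ψ'' = (V - z) ψ` whose Cauchy data at the origin is
the fixed point `p` of phase space, for all values of the spectral parameter `z`. -/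
structure IsCauchyFamily (V : ℝ → ℂ) (p : ℂ × ℂ) (U : ℂ → ℝ → ℂ × ℂ) : Prop where
  solvesOn : ∀ z, SolvesOn (fun x => V x - z) (U z) univ
  apply_zero : ∀ z, U z 0 = p

theorem isCauchyFamily_phaseCurve {V : ℝ → ℝ} {a b : ℂ} {u : ℂ → ℝ → ℂ}
    (hu : ∀ z, IsCauchySolution V z a b (u z)) :
    IsCauchyFamily (fun x => V x) (a, b) fun z => phaseCurve (u z) where
  solvesOn z := (hu z).1.solvesOn
  apply_zero z := Prod.ext (hu z).2.1 (hu z).2.2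

theorem IsNormalizedPair.exists_isCauchyFamily {V : ℝ → ℝ} {Φ : ℝ → ℂ} {u v : ℂ → ℝ → ℂ}
    (huv : IsNormalizedPair V Φ u v) (hΦ : Function.Even Φ ∨ Function.Odd Φ) :
    ∃ (p q : ℂ × ℂ) (c : ℂ), IsSelfAdjoint p ∧ IsSelfAdjoint q ∧ wronskian p q = 1 ∧
      phaseCurve Φ 0 = c • p ∧ IsCauchyFamily (fun x => V x) p (fun z => phaseCurve (u z)) ∧
      IsCauchyFamily (fun x => V x) q fun z => phaseCurve (v z) := by
  rcases hΦ with h | h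
  · have hΦ' : deriv Φ 0 = 0 := by
      have hneg := deriv_comp_neg Φ 0
      rwa [funext h, neg_zero, self_eq_neg] at hneg
    refine ⟨(1, 0), (0, 1), Φ 0, ?_, ?_, ?_, ?_,
      isCauchyFamily_phaseCurve fun z => (huv.1 h z).1,
      isCauchyFamily_phaseCurve fun z => (huv.1 h z).2⟩ <;>
    simp [IsSelfAdjoint, Prod.ext_iff, wronskian, phaseCurve, hΦ']
  · have hΦ0 : Φ 0 = 0 := h.map_zero
    refine ⟨(0, 1), (-1, 0), deriv Φ 0, ?_, ?_, ?_, ?_,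
      isCauchyFamily_phaseCurve fun z => (huv.2 h z).1,
      isCauchyFamily_phaseCurve fun z => (huv.2 h z).2⟩ <;>
    simp [IsSelfAdjoint, Prod.ext_iff, wronskian, phaseCurve, hΦ0]

namespace IsCauchyFamily

variable {V : ℝ → ℂ} {p : ℂ × ℂ} {U : ℂ → ℝ → ℂ × ℂ}

theorem wronskian_eq {q : ℂ × ℂ} {W : ℂ → ℝ → ℂ × ℂ} (hU : IsCauchyFamily V p U)
    (hW : IsCauchyFamily V q W) (e : ℂ) (x : ℝ) : wronskian (U e x) (W e x) = wronskian p q := by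
  rw [(hU.solvesOn e).wronskian_eq (hW.solvesOn e) isOpen_univ isPreconnected_univ (mem_univ x)
    (mem_univ 0), hU.apply_zero, hW.apply_zero]

theorem isSelfAdjoint {V : ℝ → ℝ} (hU : IsCauchyFamily (fun x => V x) p U) (hV : Continuous V)
    (hp : IsSelfAdjoint p) (E x : ℝ) : IsSelfAdjoint (U E x) :=
  (hU.solvesOn E).isSelfAdjoint (by fun_prop)
    (fun x => IsSelfAdjoint.sub (Complex.conj_ofReal (V x)) (Complex.conj_ofReal E))
    ((hU.apply_zero E).symm ▸ hp) x

theorem tendsto_zero_of_isBoundState {V : ℝ → ℝ} {Φ : ℝ → ℂ} {E : ℝ} {c : ℂ}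
    (hU : IsCauchyFamily (fun x => V x) p U) (hV : Continuous V)
    (hVb : (fun x => (V x - E : ℂ)) =O[atTop] fun _ => (1 : ℝ)) (hΦ : IsBoundState V E Φ)
    (hc : phaseCurve Φ 0 = c • p) : Tendsto (U E) atTop (𝓝 0) := by
  have hc0 : c ≠ 0 := fun h => hΦ.phaseCurve_zero_ne_zero hV (by rw [hc, h, zero_smul])
  have hcurve : phaseCurve Φ = fun x => c • U E x :=
    SolvesOn.ext (by fun_prop) hΦ.2.2.solvesOn ((hU.solvesOn E).const_smul c)
      (by rw [hc, hU.apply_zero])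
  have hlim := (hΦ.tendsto_phaseCurve hV hVb).const_smul c⁻¹
  simpa only [hcurve, inv_smul_smul₀ hc0, smul_zero] using hlim

theorem eq_add_smul (hU : IsCauchyFamily V p U) {e : ℂ} {G : ℝ → ℂ × ℂ}
    (hG : SolvesOn (fun x => V x - e) G univ) (hpG : wronskian p (G 0) = 1) (z : ℂ) (x : ℝ) :
    U z x = U e x + (z - e) • ((∫ y in 0..x, (U z y).1 * (G y).1) • U e x -
      (∫ y in 0..x, (U z y).1 * (U e y).1) • G x) := by
  have hUG : wronskian (U e x) (G x) = 1 := by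
    rw [(hU.solvesOn e).wronskian_eq hG isOpen_univ isPreconnected_univ (mem_univ x) (mem_univ 0),
      hU.apply_zero, hpG]
  have hzG := (hU.solvesOn z).wronskian_eq_add_integral hG (c := z - e) (fun x => by ring) 0 x
  have hze := (hU.solvesOn z).wronskian_eq_add_integral (hU.solvesOn e) (c := z - e)
    (fun x => by ring) 0 x
  simp only [hU.apply_zero, hpG, wronskian_self, zero_add] at hzG hze
  rw [eq_wronskian_smul_add hUG (U z x), wronskian_swap (U z x) (U e x), hzG, hze]
  module

theorem tendstoUniformlyOn (hU : IsCauchyFamily V p U) (hV : Continuous V) (e : ℂ) (M : ℝ) :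
    TendstoUniformlyOn U (U e) (𝓝 e) (Icc 0 M) := by
  obtain ⟨K, hK⟩ := (isCompact_Icc (a := 0) (b := M)).exists_bound_of_continuousOn hV.continuousOn
  obtain ⟨B, hB⟩ := (isCompact_Icc (a := 0) (b := M)).exists_bound_of_continuousOn
    (hU.solvesOn e).continuous.fst.continuousOn
  set K' := max 1 (K + (‖e‖ + 1))
  have hle : ∀ᶠ z in 𝓝 e, ∀ x ∈ Icc 0 M,
      ‖U z x - U e x‖ ≤ gronwallBound 0 K' (‖z - e‖ * B) M := by
    filter_upwards [Metric.ball_mem_nhds e one_pos] with z hz x hx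
    rw [mem_ball_iff_norm] at hz
    have hB0 : 0 ≤ B := (norm_nonneg _).trans (hB x hx)
    refine (((hU.solvesOn z).mono (subset_univ _)).norm_sub_le_gronwallBound
      ((hU.solvesOn e).mono (subset_univ _)) (fun y hy => ?_) (ε := ‖z - e‖ * B)
      (fun y hy => ?_) ?_ x hx).trans
      (gronwallBound_mono le_rfl (by positivity) (zero_le_one.trans (le_max_left _ _)) ?_)
    · calc ‖V y - z‖ ≤ ‖V y‖ + ‖z‖ := norm_sub_le _ _
        _ ≤ K + (‖e‖ + 1) := add_le_add (hK y hy) (by linarith [norm_le_insert' z e])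
    · calc ‖(V y - z - (V y - e)) * (U e y).1‖ = ‖z - e‖ * ‖(U e y).1‖ := by
            rw [sub_sub_sub_cancel_left, norm_mul, norm_sub_rev]
        _ ≤ ‖z - e‖ * B := by
            gcongr
            exact hB y hy
    · rw [hU.apply_zero, hU.apply_zero, sub_self, norm_zero]
    · simpa only [sub_zero] using hx.2
  have hlim : Tendsto (fun z => gronwallBound 0 K' (‖z - e‖ * B) M) (𝓝 e) (𝓝 0) := by
    have hcont : Continuous fun z => gronwallBound 0 K' (‖z - e‖ * B) M :=
      (gronwallBound_continuous_ε 0 K' M).comp (by fun_prop)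
    simpa [gronwallBound_ε0_δ0] using hcont.tendsto e
  refine Metric.tendstoUniformlyOn_iff.2 fun ε hε => ?_
  filter_upwards [hle, hlim.eventually_lt_const hε] with z hz hzε x hx
  rw [dist_comm, dist_eq_norm]
  exact (hz x hx).trans_lt hzε

theorem tendsto_integral_mul (hU : IsCauchyFamily V p U) (hV : Continuous V) (e : ℂ)
    {g : ℝ → ℂ} (hg : Continuous g) {M : ℝ} (hM : 0 ≤ M) :
    Tendsto (fun z => ∫ y in 0..M, (U z y).1 * g y) (𝓝 e) (𝓝 (∫ y in 0..M, (U e y).1 * g y)) := by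
  have hcont : ∀ z, Continuous fun y => (U z y).1 := fun z => (hU.solvesOn z).continuous.fst
  have hfst := (uniformContinuous_fst.comp_tendstoUniformlyOn
    (hU.tendstoUniformlyOn hV e M)).tendstoLocallyUniformlyOn
  have hconst : TendstoLocallyUniformlyOn (fun _ : ℂ => g) g (𝓝 e) (Icc 0 M) :=
    fun s hs _ _ => ⟨univ, univ_mem, .of_forall fun _ _ _ => refl_mem_uniformity hs⟩
  refine TendstoUniformlyOn.tendsto_intervalIntegral_of_continuousOn
    (.of_forall fun z => ((hcont z).mul hg).continuousOn) ?_
  rw [uIcc_of_le hM]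
  exact (tendstoLocallyUniformlyOn_iff_tendstoUniformlyOn_of_compact isCompact_Icc).1
    (hfst.mul₀ hconst (hcont e).continuousOn hg.continuousOn)

theorem hasDerivAt (hU : IsCauchyFamily V p U) (hV : Continuous V) {e : ℂ} {G : ℝ → ℂ × ℂ}
    (hG : SolvesOn (fun x => V x - e) G univ) (hpG : wronskian p (G 0) = 1) {M : ℝ} (hM : 0 ≤ M) :
    HasDerivAt (fun z => U z M) ((∫ y in 0..M, (U e y).1 * (G y).1) • U e M -
      (∫ y in 0..M, (U e y).1 ^ 2) • G M) e := by
  have huv := hU.tendsto_integral_mul hV e hG.continuous.fst hM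
  have huu := hU.tendsto_integral_mul hV e (hU.solvesOn e).continuous.fst hM
  simp only [sq]
  have hlim := (huv.smul_const (U e M)).sub (huu.smul_const (G M))
  refine hasDerivAt_iff_tendsto_slope.2 ((hlim.mono_left nhdsWithin_le_nhds).congr' ?_)
  filter_upwards [self_mem_nhdsWithin] with z hz
  rw [slope_def_module, eq_inv_smul_iff₀ (sub_ne_zero.2 hz), hU.eq_add_smul hG hpG z M,
    add_sub_cancel_left]

end IsCauchyFamily

/-- The functional `(ψ, ψ') ↦ ψ' - i κ ψ` on phase space, whose kernel is spanned by the Cauchy data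
of the outgoing wave `exp (i κ x)`. The incoming functional is `outgoing (-κ)`. -/
noncomputable def outgoing (κ : ℝ) (p : ℂ × ℂ) : ℂ := p.2 - Complex.I * κ * p.1

theorem outgoing_mul_outgoing_neg (κ : ℝ) (p q : ℂ × ℂ) :
    outgoing κ p * outgoing (-κ) q =
      p.2 * q.2 + κ ^ 2 * p.1 * q.1 - Complex.I * κ * wronskian p q := by
  simp only [outgoing, wronskian, Complex.ofReal_neg]
  linear_combination -p.1 * q.1 * κ ^ 2 * Complex.I_sq

theorem star_outgoing (κ : ℝ) {p : ℂ × ℂ} (hp : IsSelfAdjoint p) :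
    star (outgoing κ p) = outgoing (-κ) p := by
  have hfst : star p.1 = p.1 := congrArg Prod.fst hp.star_eq
  have hsnd : star p.2 = p.2 := congrArg Prod.snd hp.star_eq
  simp only [outgoing, star_sub, star_mul', hfst, hsnd, Complex.star_def, Complex.conj_I,
    Complex.conj_ofReal, Complex.ofReal_neg]
  ring

theorem norm_outgoing_le (κ : ℝ) (p : ℂ × ℂ) : ‖outgoing κ p‖ ≤ (1 + |κ|) * ‖p‖ :=
  calc ‖outgoing κ p‖ ≤ ‖p.2‖ + |κ| * ‖p.1‖ := by
        simpa [outgoing] using norm_sub_le p.2 (Complex.I * κ * p.1)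
    _ ≤ ‖p‖ + |κ| * ‖p‖ := by
        gcongr
        exacts [norm_snd_le p, norm_fst_le p]
    _ = (1 + |κ|) * ‖p‖ := by ring

theorem norm_le_norm_outgoing {κ : ℝ} (hκ : κ ≠ 0) {p : ℂ × ℂ} (hp : IsSelfAdjoint p) :
    ‖p‖ ≤ (1 + |κ|⁻¹) * ‖outgoing κ p‖ := by
  have hκ' : 0 < |κ| := abs_pos.2 hκ
  have hnorm : ‖outgoing (-κ) p‖ = ‖outgoing κ p‖ := by rw [← star_outgoing κ hp, norm_star]
  have hsnd : ‖2 * p.2‖ ≤ 2 * ‖outgoing κ p‖ :=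
    calc ‖2 * p.2‖ = ‖outgoing κ p + outgoing (-κ) p‖ := by
          simp only [outgoing, Complex.ofReal_neg]; ring_nf
      _ ≤ 2 * ‖outgoing κ p‖ := (norm_add_le _ _).trans_eq (by rw [hnorm, two_mul])
  have hfst : ‖2 * Complex.I * κ * p.1‖ ≤ 2 * ‖outgoing κ p‖ :=
    calc ‖2 * Complex.I * κ * p.1‖ = ‖outgoing (-κ) p - outgoing κ p‖ := by
          simp only [outgoing, Complex.ofReal_neg]; ring_nf
      _ ≤ 2 * ‖outgoing κ p‖ := (norm_sub_le _ _).trans_eq (by rw [hnorm, two_mul])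
  simp only [norm_mul, Complex.norm_ofNat, Complex.norm_I, Complex.norm_real, Real.norm_eq_abs,
    mul_one] at hfst hsnd
  have hinv : 0 ≤ |κ|⁻¹ * ‖outgoing κ p‖ := by positivity
  refine max_le ?_ ?_
  · have : ‖p.1‖ ≤ |κ|⁻¹ * ‖outgoing κ p‖ := by
      rw [inv_mul_eq_div, le_div_iff₀' hκ']
      linarith
    linarith [norm_nonneg (outgoing κ p)]
  · linarith

theorem outgoing_ne_zero {κ : ℝ} (hκ : κ ≠ 0) {p : ℂ × ℂ} (hp : IsSelfAdjoint p) (hp0 : p ≠ 0) :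
    outgoing κ p ≠ 0 := fun h =>
  hp0 (norm_le_zero_iff.1 ((norm_le_norm_outgoing hκ hp).trans_eq (by rw [h, norm_zero, mul_zero])))

theorem isBigO_integral_of_isBigO_one {E : Type*} [NormedAddCommGroup E] [NormedSpace ℝ E]
    {f : ℝ → E} (hf : Continuous f) (hb : f =O[atTop] fun _ => (1 : ℝ)) (a : ℝ) :
    (fun M => ∫ y in a..M, f y) =O[atTop] fun M => M := by
  obtain ⟨C, hC⟩ := hb.bound
  obtain ⟨b, hb⟩ := eventually_atTop.1 hC
  have hconst : (fun _ : ℝ => ∫ y in a..b, f y) =O[atTop] fun M : ℝ => M :=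
    (isLittleO_const_id_atTop _).isBigO
  have htail : (fun M => ∫ y in b..M, f y) =O[atTop] fun M => M - b := by
    refine .of_bound C ?_
    filter_upwards [eventually_ge_atTop b] with M hM
    refine intervalIntegral.norm_integral_le_of_norm_le_const fun x hx => ?_
    rw [uIoc_of_le hM] at hx
    simpa using hb x hx.1.le
  have hid : (fun M : ℝ => M - b) =O[atTop] fun M => M :=
    (isBigO_refl _ _).sub (isLittleO_const_id_atTop b).isBigO
  exact (hconst.add (htail.trans hid)).congr_left fun M =>
    intervalIntegral.integral_add_adjacent_intervals (hf.intervalIntegrable a b)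
      (hf.intervalIntegrable b M)

theorem isBigO_one_integral_sq {f : ℝ → ℂ} (hf : Continuous f) (hreal : ∀ x, IsSelfAdjoint (f x))
    {a b : ℝ} (hab : a < b) (hb : f b ≠ 0) :
    (fun _ => (1 : ℝ)) =O[atTop] fun M => ∫ y in a..M, f y ^ 2 := by
  have hre : ∀ x, ((f x).re : ℂ) = f x := fun x => Complex.conj_eq_iff_re.1 (hreal x)
  have hcont : Continuous fun x => (f x).re ^ 2 := (Complex.continuous_re.comp hf).pow 2
  have hpos : 0 < ∫ y in a..b, (f y).re ^ 2 := by
    refine intervalIntegral.integral_pos hab hcont.continuousOn (fun y _ => sq_nonneg _)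
      ⟨b, right_mem_Icc.2 hab.le, sq_pos_of_ne_zero fun h => hb ?_⟩
    rw [← hre b, h, Complex.ofReal_zero]
  refine .of_bound (∫ y in a..b, (f y).re ^ 2)⁻¹ ?_
  filter_upwards [eventually_ge_atTop b] with M hM
  have hM' : ∫ y in a..M, f y ^ 2 = ((∫ y in a..M, (f y).re ^ 2 : ℝ) : ℂ) := by
    simp only [← intervalIntegral.integral_ofReal, Complex.ofReal_pow, hre]
  have hmono : ∫ y in a..b, (f y).re ^ 2 ≤ ∫ y in a..M, (f y).re ^ 2 :=
    intervalIntegral.integral_mono_interval le_rfl hab.le hM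
      (.of_forall fun y => sq_nonneg _) (hcont.intervalIntegrable _ _)
  rw [hM', Complex.norm_real, norm_one, inv_mul_eq_div, one_le_div₀ hpos]
  exact hmono.trans (le_abs_self _)

theorem exp_isBigO_of_wronskian_eq_one {F G : ℝ → ℂ × ℂ} {k : ℝ}
    (hFG : ∀ x, wronskian (F x) (G x) = 1) (hF : F =O[atTop] fun x => Real.exp (-k * x)) :
    (fun x => Real.exp (k * x)) =O[atTop] G := by
  have hone : (fun _ => (1 : ℝ)) =O[atTop] fun x => ‖F x‖ * ‖G x‖ :=
    .of_bound 2 (.of_forall fun x => by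
      simpa [hFG x] using norm_wronskian_le (F x) (G x))
  have hmul := (isBigO_refl (fun x => Real.exp (k * x)) atTop).mul
    (hone.trans (hF.norm_left.mul (isBigO_refl (fun x => ‖G x‖) atTop)))
  refine (hmul.congr (fun x => mul_one _) fun x => ?_).of_norm_right
  rw [← mul_assoc, ← Real.exp_add, neg_mul, add_neg_cancel, Real.exp_zero, one_mul]

theorem mul_exp_neg_isLittleO_exp {k : ℝ} (hk : 0 < k) :
    (fun M => M * Real.exp (-k * M)) =o[atTop] fun M => Real.exp (k * M) := by
  have h := (isLittleO_pow_exp_pos_mul_atTop 1 (mul_pos two_pos hk)).mul_isBigO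
    (isBigO_refl (fun M => Real.exp (-k * M)) atTop)
  refine h.congr (fun M => by rw [pow_one]) fun M => ?_
  rw [← Real.exp_add]
  ring_nf

theorem isBigO_div_sub_add_div {α 𝕜 : Type*} [NormedField 𝕜] {l : Filter α} {p r D : α → 𝕜}
    (hr : r =o[l] D) (hD : ∀ᶠ x in l, D x ≠ 0) :
    (fun x => p x / (r x - D x) + p x / D x) =O[l] fun x => p x * r x / D x ^ 2 := by
  have hsub : D =O[l] fun x => r x - D x :=
    hr.right_isBigO_sub.neg_right.congr_right fun x => neg_sub _ _
  have hinv : (fun x => (r x - D x)⁻¹) =O[l] fun x => (D x)⁻¹ :=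
    hsub.inv_rev (hD.mono fun x hx h => absurd h hx)
  refine ((isBigO_refl (fun x => p x * r x / D x) l).mul hinv).congr' ?_ ?_
  · filter_upwards [hD, hsub.eq_zero_imp] with x hx hx'
    have : r x - D x ≠ 0 := mt hx' hx
    field_simp
    ring
  · exact .of_forall fun x => by simp only [div_eq_mul_inv, sq, mul_inv, mul_assoc]

/-- The dominant part of `-∂_z Θ(E)`, in terms of the phase curves `F` of `u_E` and `G` of `v_E`
and of `κ = √E`. -/
noncomputable def thetaDerivMain (κ : ℝ) (F G : ℝ → ℂ × ℂ) (M : ℝ) : ℂ :=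
  outgoing κ (G M) * ∫ y in 0..M, (F y).1 ^ 2

/-- The remainder `∂_z Θ(E) + thetaDerivMain κ F G M`, in the same notation. -/
noncomputable def thetaDerivRemainder (κ : ℝ) (F G : ℝ → ℂ × ℂ) (M : ℝ) : ℂ :=
  outgoing κ (F M) * (∫ y in 0..M, (F y).1 * (G y).1) - Complex.I / (2 * κ) * (F M).1

section Theta

variable {u v : ℂ → ℝ → ℂ} {E M : ℝ}

theorem ofReal_cpow_one_half (hE : 0 ≤ E) : (E : ℂ) ^ (1 / 2 : ℂ) = (√E : ℝ) := by
  rw [Real.sqrt_eq_rpow, Complex.ofReal_cpow hE]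
  norm_num

theorem theta_ofReal (hE : 0 ≤ E) : Theta u M E = outgoing √E (phaseCurve (u E) M) := by
  rw [Theta, ofReal_cpow_one_half hE, outgoing, phaseCurve]

theorem hasDerivAt_cpow_one_half (hE : 0 < E) :
    HasDerivAt (fun z : ℂ => z ^ (1 / 2 : ℂ)) (1 / (2 * √E)) (E : ℂ) := by
  refine ((hasDerivAt_id (E : ℂ)).cpow_const (c := (1 / 2 : ℂ))
    (Complex.ofReal_mem_slitPlane.2 hE)).congr_deriv ?_
  rw [show (1 / 2 - 1 : ℂ) = -(1 / 2) by norm_num, id_eq, Complex.cpow_neg,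
    ofReal_cpow_one_half hE.le]
  ring

theorem IsCauchyFamily.hasDerivAt_theta {V : ℝ → ℂ} {p : ℂ × ℂ} {G : ℝ → ℂ × ℂ}
    (hU : IsCauchyFamily V p fun z => phaseCurve (u z)) (hV : Continuous V) (hE : 0 < E)
    (hG : SolvesOn (fun x => V x - E) G univ) (hpG : wronskian p (G 0) = 1) (hM : 0 ≤ M) :
    HasDerivAt (Theta u M) (thetaDerivRemainder √E (phaseCurve (u E)) G M -
      thetaDerivMain √E (phaseCurve (u E)) G M) E := by
  have hd := hU.hasDerivAt hV hG hpG hM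
  have hu : HasDerivAt (fun z => u z M) _ (E : ℂ) := hd.fst
  have hu' : HasDerivAt (fun z => deriv (u z) M) _ (E : ℂ) := hd.snd
  refine (hu'.sub (((hasDerivAt_cpow_one_half hE).const_mul Complex.I).mul hu)).congr_deriv ?_
  simp only [ofReal_cpow_one_half hE.le, thetaDerivRemainder, thetaDerivMain, outgoing,
    Prod.fst_sub, Prod.snd_sub, Prod.smul_fst, Prod.smul_snd, smul_eq_mul, phaseCurve]
  ring

theorem deriv_sq_add_mul_sq (hE : 0 ≤ E) :
    deriv (v E) M ^ 2 + (E : ℂ) * v E M ^ 2 =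
      outgoing √E (phaseCurve (v E) M) * outgoing (-√E) (phaseCurve (v E) M) := by
  have hsq : ((√E : ℝ) : ℂ) ^ 2 = E := mod_cast Real.sq_sqrt hE
  rw [outgoing_mul_outgoing_neg, wronskian_self, hsq, phaseCurve]
  ring

theorem explicitCorrection_eq (hE : 0 ≤ E)
    (huv : wronskian (phaseCurve (u E) M) (phaseCurve (v E) M) = 1)
    (hv : outgoing (-√E) (phaseCurve (v E) M) ≠ 0) :
    explicitCorrection u v E M = -(Theta u M E /
      thetaDerivMain √E (phaseCurve (u E)) (phaseCurve (v E)) M) := by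
  have hsq : ((√E : ℝ) : ℂ) ^ 2 = E := mod_cast Real.sq_sqrt hE
  have hnum : Complex.I * (√E : ℝ) - (deriv (u E) M * deriv (v E) M + E * u E M * v E M) =
      -(Theta u M E * outgoing (-√E) (phaseCurve (v E) M)) := by
    rw [theta_ofReal hE, outgoing_mul_outgoing_neg, huv, hsq, phaseCurve, phaseCurve]
    ring
  rw [explicitCorrection, hnum, deriv_sq_add_mul_sq hE, mul_right_comm, neg_div,
    mul_div_mul_right _ _ hv, thetaDerivMain]
  rfl

end Theta

/-- `F` and `G` are the phase curves of two real solutions of `ψ'' = Q ψ` with unit Wronskian, the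
first decaying at the exponential rate `k` and the second growing at most at that rate. -/
structure IsExponentialPair (Q : ℝ → ℂ) (k : ℝ) (F G : ℝ → ℂ × ℂ) : Prop where
  solvesOn_left : SolvesOn Q F univ
  solvesOn_right : SolvesOn Q G univ
  isSelfAdjoint_left : ∀ x, IsSelfAdjoint (F x)
  isSelfAdjoint_right : ∀ x, IsSelfAdjoint (G x)
  wronskian_eq_one : ∀ x, wronskian (F x) (G x) = 1
  isBigO_left : F =O[atTop] fun x => Real.exp (-k * x)
  isBigO_right : G =O[atTop] fun x => Real.exp (k * x)

namespace IsExponentialPair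

variable {Q : ℝ → ℂ} {k κ : ℝ} {F G : ℝ → ℂ × ℂ}

theorem outgoing_right_ne_zero (h : IsExponentialPair Q k F G) (hκ : κ ≠ 0) (x : ℝ) :
    outgoing κ (G x) ≠ 0 :=
  outgoing_ne_zero hκ (h.isSelfAdjoint_right x)
    (right_ne_zero_of_wronskian_eq_one (h.wronskian_eq_one x))

theorem isBigO_outgoing_left (h : IsExponentialPair Q k F G) :
    (fun x => outgoing κ (F x)) =O[atTop] fun x => Real.exp (-k * x) :=
  .trans (.of_bound _ (.of_forall fun x => norm_outgoing_le κ (F x))) h.isBigO_left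

theorem isBigO_thetaDerivRemainder (h : IsExponentialPair Q k F G) :
    thetaDerivRemainder κ F G =O[atTop] fun M => M * Real.exp (-k * M) := by
  have hF : (fun x => (F x).1) =O[atTop] fun x => Real.exp (-k * x) :=
    isBigO_fst_prod'.trans h.isBigO_left
  have hG : (fun x => (G x).1) =O[atTop] fun x => Real.exp (k * x) :=
    isBigO_fst_prod'.trans h.isBigO_right
  have hone : (fun x => (F x).1 * (G x).1) =O[atTop] fun _ => (1 : ℝ) :=
    (hF.mul hG).congr_right fun x => by
      rw [← Real.exp_add, neg_mul, neg_add_cancel, Real.exp_zero]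
  have hint := isBigO_integral_of_isBigO_one
    (h.solvesOn_left.continuous.fst.mul h.solvesOn_right.continuous.fst) hone 0
  have hle : (fun M => Real.exp (-k * M)) =O[atTop] fun M => M * Real.exp (-k * M) := by
    simpa only [one_mul, id] using
      (isLittleO_const_id_atTop (1 : ℝ)).isBigO.mul (isBigO_refl (fun M => Real.exp (-k * M)) atTop)
  exact ((h.isBigO_outgoing_left.mul hint).congr_right fun M => mul_comm _ _).sub
    ((hF.const_mul_left _).trans hle)

theorem exp_isBigO_outgoing_right (h : IsExponentialPair Q k F G) (hκ : κ ≠ 0) :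
    (fun x => Real.exp (k * x)) =O[atTop] fun x => outgoing κ (G x) :=
  (exp_isBigO_of_wronskian_eq_one h.wronskian_eq_one h.isBigO_left).trans
    (.of_bound _ (.of_forall fun x => norm_le_norm_outgoing hκ (h.isSelfAdjoint_right x)))

theorem exp_isBigO_thetaDerivMain (h : IsExponentialPair Q k F G) (hκ : κ ≠ 0) :
    (fun x => Real.exp (k * x)) =O[atTop] thetaDerivMain κ F G := by
  obtain ⟨b, hb, hFb⟩ := (h.solvesOn_left.mono (subset_univ (Ioi 0))).exists_fst_ne_zero
    isOpen_Ioi (mem_Ioi.2 one_pos)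
    (left_ne_zero_of_wronskian_eq_one (h.wronskian_eq_one 1))
  have hint := isBigO_one_integral_sq h.solvesOn_left.continuous.fst
    (fun x => congrArg Prod.fst (h.isSelfAdjoint_left x).star_eq) hb hFb
  exact ((h.exp_isBigO_outgoing_right hκ).mul hint).congr_left fun x => mul_one _

theorem eventually_thetaDerivMain_ne_zero (h : IsExponentialPair Q k F G) (hκ : κ ≠ 0) :
    ∀ᶠ M in atTop, thetaDerivMain κ F G M ≠ 0 :=
  (h.exp_isBigO_thetaDerivMain hκ).eq_zero_imp.mono fun _ hM => mt hM (Real.exp_pos _).ne'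

theorem thetaDerivRemainder_isLittleO (h : IsExponentialPair Q k F G) (hκ : κ ≠ 0) (hk : 0 < k) :
    thetaDerivRemainder κ F G =o[atTop] thetaDerivMain κ F G :=
  (h.isBigO_thetaDerivRemainder.trans_isLittleO (mul_exp_neg_isLittleO_exp hk)).trans_isBigO
    (h.exp_isBigO_thetaDerivMain hκ)

theorem isBigO_outgoing_div_add_div (h : IsExponentialPair Q k F G) (hκ : κ ≠ 0) (hk : 0 < k) :
    (fun M => outgoing κ (F M) / (thetaDerivRemainder κ F G M - thetaDerivMain κ F G M) +
      outgoing κ (F M) / thetaDerivMain κ F G M) =O[atTop]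
      fun M => M * Real.exp (-4 * k * M) := by
  have hinv : (fun M => (thetaDerivMain κ F G M)⁻¹) =O[atTop] fun M => Real.exp (-k * M) :=
    ((h.exp_isBigO_thetaDerivMain hκ).inv_rev (.of_forall fun _ h0 =>
      absurd h0 (Real.exp_pos _).ne')).congr_right fun M => by rw [neg_mul, Real.exp_neg]
  have hprod := (h.isBigO_outgoing_left (κ := κ)).mul (h.isBigO_thetaDerivRemainder (κ := κ))
    |>.mul (hinv.pow 2)
  refine (isBigO_div_sub_add_div (h.thetaDerivRemainder_isLittleO hκ hk)
    (h.eventually_thetaDerivMain_ne_zero hκ)).trans (hprod.congr (fun M => ?_) fun M => ?_)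
  · rw [inv_pow, div_eq_mul_inv]
  · have hexp : Real.exp (-4 * k * M) = Real.exp (-k * M) ^ 4 := by
      rw [← Real.exp_nat_mul]
      ring_nf
    rw [hexp]
    ring

variable {V : ℝ → ℂ} {p : ℂ × ℂ} {u v : ℂ → ℝ → ℂ} {E : ℝ}

theorem eventually_hasDerivAt_theta
    (h : IsExponentialPair (fun x => V x - E) k (phaseCurve (u E)) (phaseCurve (v E)))
    (hU : IsCauchyFamily V p fun z => phaseCurve (u z)) (hV : Continuous V) (hE : 0 < E) :
    ∀ᶠ M in atTop, HasDerivAt (Theta u M)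
      (thetaDerivRemainder √E (phaseCurve (u E)) (phaseCurve (v E)) M -
        thetaDerivMain √E (phaseCurve (u E)) (phaseCurve (v E)) M) E := by
  filter_upwards [eventually_ge_atTop 0] with M hM
  exact hU.hasDerivAt_theta hV hE h.solvesOn_right (hU.apply_zero E ▸ h.wronskian_eq_one 0) hM

theorem eventually_deriv_theta_ne_zero
    (h : IsExponentialPair (fun x => V x - E) k (phaseCurve (u E)) (phaseCurve (v E)))
    (hU : IsCauchyFamily V p fun z => phaseCurve (u z)) (hV : Continuous V) (hE : 0 < E)
    (hk : 0 < k) : ∀ᶠ M in atTop, deriv (Theta u M) E ≠ 0 := by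
  have hκ : √E ≠ 0 := (Real.sqrt_pos.2 hE).ne'
  filter_upwards [h.eventually_hasDerivAt_theta hU hV hE, h.eventually_thetaDerivMain_ne_zero hκ,
    (h.thetaDerivRemainder_isLittleO hκ hk).right_isBigO_sub.eq_zero_imp] with M hderiv hD hsub
  rw [hderiv.deriv, ← neg_sub, neg_ne_zero]
  exact mt hsub hD

theorem eventually_denominator_ne_zero
    (h : IsExponentialPair Q k (phaseCurve (u E)) (phaseCurve (v E))) (hE : 0 < E) :
    ∀ᶠ M in atTop, (deriv (v E) M ^ 2 + (E : ℂ) * v E M ^ 2) *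
      (∫ y in (0 : ℝ)..M, u E y ^ 2) ≠ 0 := by
  have hκ : √E ≠ 0 := (Real.sqrt_pos.2 hE).ne'
  filter_upwards [h.eventually_thetaDerivMain_ne_zero hκ] with M hD
  rw [deriv_sq_add_mul_sq hE.le, mul_right_comm]
  exact mul_ne_zero hD (h.outgoing_right_ne_zero (neg_ne_zero.2 hκ) M)

theorem isBigO_theta_div_deriv_sub_explicitCorrection
    (h : IsExponentialPair (fun x => V x - E) k (phaseCurve (u E)) (phaseCurve (v E)))
    (hU : IsCauchyFamily V p fun z => phaseCurve (u z)) (hV : Continuous V) (hE : 0 < E)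
    (hk : 0 < k) :
    (fun M => Theta u M E / deriv (Theta u M) E - explicitCorrection u v E M) =O[atTop]
      fun M => M * Real.exp (-4 * k * M) := by
  have hκ : √E ≠ 0 := (Real.sqrt_pos.2 hE).ne'
  refine (h.isBigO_outgoing_div_add_div hκ hk).congr' ?_ .rfl
  filter_upwards [h.eventually_hasDerivAt_theta hU hV hE] with M hderiv
  rw [explicitCorrection_eq hE.le (h.wronskian_eq_one M)
    (h.outgoing_right_ne_zero (neg_ne_zero.2 hκ) M), sub_neg_eq_add, hderiv.deriv,
    theta_ofReal hE.le]

end IsExponentialPair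

theorem isBigO_one_of_eqOn_periodic {V W : ℝ → ℝ} {ρ : ℝ} (hV : Continuous V)
    (hVW : EqOn V W (Ioi ρ)) (hW : ∀ x, W (x + 1) = W x) (E : ℝ) :
    (fun x => (V x - E : ℂ)) =O[atTop] fun _ => (1 : ℝ) := by
  have hmult : HasMultiplierOnIoi 1 ρ fun x => (V x - E : ℂ) := fun x hx => by
    have hx1 : ρ < x + 1 := hx.trans (lt_add_one x)
    simp only [hVW hx, hVW hx1, hW, one_smul]
  simpa using hmult.isBigO_exp one_ne_zero (by fun_prop)

theorem IsBoundState.exists_isExponentialPair {V W : ℝ → ℝ} {ρ E : ℝ} {Φ : ℝ → ℂ}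
    {u v : ℂ → ℝ → ℂ} (hΦ : IsBoundState V E Φ) (hV : Continuous V) (heven : Function.Even V)
    (hVW : EqOn V W (Ioi ρ)) (hW : ∀ x, W (x + 1) = W x) (huv : IsNormalizedPair V Φ u v) :
    ∃ k p, 0 < k ∧
      IsGreatest {r : ℝ | ∃ μ : ℂ, IsFloquetMultiplier W E μ ∧ r = ‖μ‖} (Real.exp k) ∧
      IsCauchyFamily (fun x => V x) p (fun z => phaseCurve (u z)) ∧
      IsExponentialPair (fun x => V x - E) k (phaseCurve (u E)) (phaseCurve (v E)) := by
  have hVb := isBigO_one_of_eqOn_periodic hV hVW hW E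
  obtain ⟨p, q, c, hp, hq, hpq, hc, hU, hW'⟩ :=
    huv.exists_isCauchyFamily (hΦ.even_or_odd hV heven hVb)
  have hQ : EqOn (fun x => (V x - E : ℂ)) (fun x => W x - E) (Ioi ρ) := fun x hx => by
    simp only [hVW hx]
  have hone : ∀ x, wronskian (phaseCurve (u E) x) (phaseCurve (v E) x) = 1 := fun x =>
    (hU.wronskian_eq hW' E x).trans hpq
  obtain ⟨k, hk, hgreatest, hdecay, hgrowth⟩ := exists_isGreatest_norm_isFloquetMultiplier hW
    (((hU.solvesOn E).mono (subset_univ _)).congr hQ)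
    (((hW'.solvesOn E).mono (subset_univ _)).congr hQ) (fun x _ => hone x)
    (hU.tendsto_zero_of_isBoundState hV hVb hΦ hc)
  exact ⟨k, p, hk, hgreatest, hU, hU.solvesOn E, hW'.solvesOn E, hU.isSelfAdjoint hV hp E,
    hW'.isSelfAdjoint hV hq E, hone, hdecay, hgrowth⟩

theorem mainTheorem2_general
    (V Vper : ℝ → ℝ) (ρ : ℝ) (hV : Continuous V) (hVper : ∀ x, ρ < x → V x = Vper x)
    (hper : ∀ x : ℝ, Vper (x + 1) = Vper x) (heven : ∀ x : ℝ, V (-x) = V x)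
    (E : ℝ) (hE : 0 < E) (Φ : ℝ → ℂ) (hΦ : IsBoundState V E Φ)
    (u v : ℂ → ℝ → ℂ) (huv : IsNormalizedPair V Φ u v) :
    ∃ k : ℝ, 0 < k ∧
      IsGreatest {r : ℝ | ∃ μ : ℂ, IsFloquetMultiplier Vper E μ ∧ r = ‖μ‖} (Real.exp k) ∧
      ∃ C M₀ : ℝ, ρ < M₀ ∧ ∀ M : ℝ, M₀ ≤ M →
        DifferentiableAt ℂ (Theta u M) (E : ℂ) ∧
        deriv (Theta u M) (E : ℂ) ≠ 0 ∧
        (deriv (v E) M ^ 2 + (E : ℂ) * v E M ^ 2) * (∫ y in (0 : ℝ)..M, u E y ^ 2) ≠ 0 ∧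
        ‖Theta u M (E : ℂ) / deriv (Theta u M) (E : ℂ) - explicitCorrection u v E M‖
          ≤ C * (M * Real.exp (-4 * k * M)) := by
  obtain ⟨k, p, hk, hgreatest, hU, huvk⟩ := hΦ.exists_isExponentialPair hV heven hVper hper huv
  have hVc : Continuous fun x => (V x : ℂ) := by fun_prop
  obtain ⟨C, hC⟩ := (huvk.isBigO_theta_div_deriv_sub_explicitCorrection hU hVc hE hk).bound
  obtain ⟨M₀, hM₀⟩ := eventually_atTop.1 <| (eventually_ge_atTop 0).and <|
    (huvk.eventually_hasDerivAt_theta hU hVc hE).and <|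
    (huvk.eventually_deriv_theta_ne_zero hU hVc hE hk).and <|
    (huvk.eventually_denominator_ne_zero hE).and hC
  refine ⟨k, hk, hgreatest, C, max M₀ (ρ + 1), lt_max_of_lt_right (lt_add_one ρ), fun M hM => ?_⟩
  obtain ⟨hM0, hderiv, hne, hden, hbound⟩ := hM₀ M ((le_max_left _ _).trans hM)
  rw [Real.norm_of_nonneg (by positivity)] at hbound
  exact ⟨hderiv.differentiableAt, hne, hden, hbound⟩

theorem mainTheorem2
    (V Vper Vdef : ℝ → ℝ) (ρ : ℝ) (hρ : 0 ≤ ρ)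
    (hV : ContDiff ℝ ((⊤ : ℕ∞) : WithTop ℕ∞) V)
    (hsum : ∀ x : ℝ, V x = Vper x + Vdef x)
    (hper : ∀ x : ℝ, Vper (x + 1) = Vper x)
    (hdef : ∀ x : ℝ, ρ < |x| → Vdef x = 0)
    (heven : ∀ x : ℝ, V (-x) = V x)
    (E : ℝ) (hE : 0 < E)
    (Φ : ℝ → ℂ) (hΦ : IsBoundState V E Φ)
    (u v : ℂ → ℝ → ℂ) (huv : IsNormalizedPair V Φ u v) :
    ∃ k : ℝ, 0 < k ∧
      IsGreatest {r : ℝ | ∃ μ : ℂ, IsFloquetMultiplier Vper E μ ∧ r = ‖μ‖} (Real.exp k) ∧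
      ∃ C M₀ : ℝ, ρ < M₀ ∧ ∀ M : ℝ, M₀ ≤ M →
        DifferentiableAt ℂ (Theta u M) (E : ℂ) ∧
        deriv (Theta u M) (E : ℂ) ≠ 0 ∧
        (deriv (v E) M ^ 2 + (E : ℂ) * v E M ^ 2) * (∫ y in (0 : ℝ)..M, u E y ^ 2) ≠ 0 ∧
        ‖Theta u M (E : ℂ) / deriv (Theta u M) (E : ℂ) - explicitCorrection u v E M‖
          ≤ C * (M * Real.exp (-4 * k * M)) :=
  mainTheorem2_general V Vper ρ hV.continuous
    (fun x hx => by rw [hsum, hdef x (hx.trans_le (le_abs_self x)), add_zero])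
    hper heven E hE Φ hΦ u v huv
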